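/- Let $\mathcal P[0,1]$ be the space of Borel probability measures on $[0,1]$ with the weak topology, and $\lambda$ the Lebesgue measure on $[0,1]$. A *qmm-space* (quantum metric measure space) is a triple $X=(X,\mu_X,d_X)$, where $X$ is a standard Borel space, $\mu_X$ is a Borel probability measure on $X$, and $d_X:X\times X\to\mathcal P[0,1]$ is a Borel map with $d_X(x,x)=\delta_0$ and $d_X(x,y)=d_X(y,x)$, such that for $\mu_X^3$-almost every triple $(a,b,c)$, if $a,b,c$ are distinct, then independent random lengths $l(a,b),l(b,c),l(a,c)$ with laws $d_X(a,b),d_X(b,c),d_X(a,c)$ almost surely satisfy the three triangle inequalities. Let $M_\infty$ be the space of infinite symmetric matrices $(d_{i,j})_{i,j\ge1}$ with entries in $[0,1]$ and zero diagonal. For a sequence $x=(x_i)$ in $X$ let $s_x$ be the probability measure on $M_\infty$ under which the entries $d_{i,j}$, $i<j$, are independent with laws $d_X(x_i,x_j)$. The *sampling measure* $\tau(X)$ is the barycenter $\tau(X)=\int s_x\,d\mu_X^{\mathbb N}(x)$, a Borel probability measure on $M_\infty$. Let $d_{ext}(\mu,\nu)=\sup\{|\int f\,d\mu-\int f\,d\nu|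 : f:[0,1]\to\mathbb R \text{ 1-Lipschitz}\}$ on $\mathcal P[0,1]$. For $f,g:[0,1]^2\to\mathcal P[0,1]$ (measurable, and regarded modulo $\lambda^2$-null sets) let $\square_1(f,g)$ be the infimum of all $\varepsilon\ge0$ for which there is a measurable set $S\subseteq[0,1]$ with $\lambda(S)\le\varepsilon$ such that $d_{ext}(f(s,t),g(s,t))\le\varepsilon$ for $\lambda^2$-almost every $(s,t)\in([0,1]\setminus S)^2$. Let $MPM(X)$ be the set of measure-preserving maps $\Psi:([0,1],\lambda)\to(X,\mu_X)$, write $\Psi^{-1}(d_X)(s,t)=d_X(\Psi(s),\Psi(t))$, and put $$\underline{\square}_1(X,Y)=\inf_{\Psi_1\in MPM(X),\ \Psi_2\in MPM(Y)}\square_1\big(\Psi_1^{-1}(d_X),\Psi_2^{-1}(d_Y)\big).$$ **Theorem.** Let $X,Y$ be qmm-spaces. Then $\tau(X)=\tau(Y)$ if and only if $\underline{\square}_1(X,Y)=0$. In fact, if $\tau(X)=\tau(Y)$, then there exist $\Psi_1\in MPM(X)$ and $\Psi_2\in MPM(Y)$ such that $\Psi_1^{-1}(d_X)=\Psi_2^{-1}(d_Y)$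 $\lambda^2$-almost everywhere on $[0,1]^2$. -/

import Mathlib

open MeasureTheory unitInterval
open scoped ENNReal

noncomputable section

/-- A quantum metric measure space on the standard Borel space `X`: a Borel probability measure
`μ` and a symmetric Borel map `d : X × X → 𝒫[0,1]` with `d x x = δ₀`, such that for almost every
triple of distinct points the independent random lengths of the three sides satisfy the triangle
inequalities almost surely. The `σ`-algebra on `ProbabilityMeasure I` is generated by the
evaluations `ν ↦ ν A`; it is the Borel `σ`-algebra of the weak topology. -/
structure QMMSpace (X : Type*) [MeasurableSpace X] [StandardBorelSpace X] where
  μ : ProbabilityMeasure X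
  d : X → X → ProbabilityMeasure I
  measurable_d : Measurable fun p : X × X => d p.1 p.2
  d_self : ∀ x, d x x = diracProba 0
  d_symm : ∀ x y, d x y = d y x
  triangle : ∀ᵐ t : X × X × X ∂((μ : Measure X).prod ((μ : Measure X).prod (μ : Measure X))),
    t.1 ≠ t.2.1 → t.2.1 ≠ t.2.2 → t.1 ≠ t.2.2 →
      ∀ᵐ l : I × I × I ∂((d t.1 t.2.1 : Measure I).prod
          ((d t.2.1 t.2.2 : Measure I).prod (d t.1 t.2.2 : Measure I))),
        (l.1 : ℝ) ≤ l.2.1 + l.2.2 ∧ (l.2.1 : ℝ) ≤ l.1 + l.2.2 ∧ (l.2.2 : ℝ) ≤ l.1 + l.2.1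

namespace QMMSpace

/-- `M_∞`: the infinite symmetric matrices with entries in `[0,1]` and zero diagonal. -/
def DistMatrix : Type := {m : ℕ → ℕ → I // (∀ i j, m i j = m j i) ∧ ∀ i, m i i = 0}

instance : MeasurableSpace DistMatrix := inferInstanceAs (MeasurableSpace (Subtype _))

/-- `M̂_∞`: the infinite symmetric matrices with entries in `𝒫[0,1]` and diagonal `δ₀`. -/
def LawMatrix : Type :=
  {m : ℕ → ℕ → ProbabilityMeasure I // (∀ i j, m i j = m j i) ∧
    ∀ i, m i i = diracProba 0}

instance : MeasurableSpace LawMatrix := inferInstanceAs (MeasurableSpace (Subtype _))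

/-- The positions above the diagonal. -/
abbrev Pairs : Type := {p : ℕ × ℕ // p.1 < p.2}

/-- The symmetric matrix with zero diagonal and the given entries above the diagonal. -/
def symmetrize (u : Pairs → I) : DistMatrix :=
  ⟨fun i j => if h : i < j then u ⟨(i, j), h⟩ else if h : j < i then u ⟨(j, i), h⟩ else 0, by
    refine ⟨fun i j => ?_, fun i => by simp⟩
    rcases lt_trichotomy i j with h | h | h
    · simp [h, h.not_gt]
    · simp [h]
    · simp [h, h.not_gt]⟩

theorem measurable_symmetrize : Measurable symmetrize := by
  refine Measurable.subtype_mk (measurable_pi_iff.2 fun i => measurable_pi_iff.2 fun j => ?_)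
  by_cases h : i < j
  · simpa [h] using measurable_pi_apply _
  · by_cases h' : j < i
    · simpa [h, h'] using measurable_pi_apply _
    · simp [h, h']

/-- The probability measure on `M_∞` defined by `s ∈ M̂_∞`: the entries above the diagonal are
independent with laws `s i j`. -/
def LawMatrix.toMeasure (s : LawMatrix) : Measure DistMatrix :=
  (Measure.infinitePi fun p : Pairs => (s.1 p.1.1 p.1.2 : Measure I)).map symmetrize

instance (s : LawMatrix) : IsProbabilityMeasure s.toMeasure :=
  Measure.isProbabilityMeasure_map measurable_symmetrize.aemeasurable

theorem LawMatrix.measurable_toMeasure : Measurable LawMatrix.toMeasure := by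
  refine (Measure.measurable_map _ measurable_symmetrize).comp ?_
  refine Measurable.measure_of_isPiSystem_of_isProbabilityMeasure
    generateFrom_squareCylinders.symm
    (isPiSystem_squareCylinders (fun _ => MeasurableSpace.isPiSystem_measurableSet) (by simp)) ?_
  rintro _ ⟨s, t, ht, rfl⟩
  have ht' : ∀ p, MeasurableSet (t p) := fun p => ht p (Set.mem_univ p)
  simp_rw [Measure.infinitePi_pi _ fun p _ => ht' p]
  refine Finset.measurable_prod _ fun p _ => (Measure.measurable_coe (ht' p)).comp ?_
  exact measurable_subtype_coe.comp ((measurable_pi_apply _).comp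
    ((measurable_pi_apply _).comp measurable_subtype_coe))

variable {X : Type*} [MeasurableSpace X] [StandardBorelSpace X]

/-- The map `X^ℕ → M̂_∞`, `(x_i) ↦ (d (x_i) (x_j))`. -/
def lawMatrix (Q : QMMSpace X) (x : ℕ → X) : LawMatrix :=
  ⟨fun i j => Q.d (x i) (x j), fun _ _ => Q.d_symm _ _, fun _ => Q.d_self _⟩

theorem measurable_lawMatrix (Q : QMMSpace X) : Measurable Q.lawMatrix :=
  Measurable.subtype_mk (measurable_pi_iff.2 fun i => measurable_pi_iff.2 fun j =>
    Q.measurable_d.comp ((measurable_pi_apply i).prodMk (measurable_pi_apply j)))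

/-- The law `ν` on `M̂_∞`: the push-forward of `μ × μ × ⋯`. -/
def lawMatrixMeasure (Q : QMMSpace X) : Measure LawMatrix :=
  (Measure.infinitePi fun _ : ℕ => (Q.μ : Measure X)).map Q.lawMatrix

instance (Q : QMMSpace X) : IsProbabilityMeasure Q.lawMatrixMeasure :=
  Measure.isProbabilityMeasure_map Q.measurable_lawMatrix.aemeasurable

/-- The sampling measure `τ(X)` on `M_∞`: the barycenter of the law `ν`, that is
`τ(X)(A) = ∫ s(A) dν(s)`. -/
def τ (Q : QMMSpace X) : ProbabilityMeasure DistMatrix :=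
  ⟨Q.lawMatrixMeasure.bind LawMatrix.toMeasure, ⟨by
    rw [Measure.bind_apply MeasurableSet.univ LawMatrix.measurable_toMeasure.aemeasurable]
    simp⟩⟩

/-- Measure preserving maps `([0,1], λ) → (X, μ)`. -/
def MPM (Q : QMMSpace X) : Type _ := {Ψ : I → X // MeasurePreserving Ψ volume (Q.μ : Measure X)}

/-- The pull-back of the distance function of `X` to `[0,1] × [0,1]`. -/
def pullback (Q : QMMSpace X) (Ψ : Q.MPM) : I → I → ProbabilityMeasure I :=
  fun s t => Q.d (Ψ.1 s) (Ψ.1 t)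

/-- The extension of the distance of `[0,1]` to `𝒫[0,1]`. -/
def dExt (μ ν : ProbabilityMeasure I) : ℝ≥0∞ :=
  ⨆ (f : I → ℝ) (_ : LipschitzWith 1 f),
    ENNReal.ofReal |∫ t, f t ∂(μ : Measure I) - ∫ t, f t ∂(ν : Measure I)|

/-- The `□₁`-distance of `𝒫[0,1]`-valued functions on `[0,1]²`, as classes modulo null sets: the
infimal `ε` such that `f` and `g` are `ε`-close at almost every point of `Sᶜ × Sᶜ`, for some
`S ⊆ [0,1]` of measure at most `ε`. -/
def box (f g : I → I → ProbabilityMeasure I) : ℝ≥0∞ :=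
  sInf {ε | ∃ S : Set I, MeasurableSet S ∧ volume S ≤ ε ∧
    ∀ᵐ p : I × I ∂(volume.prod volume), p.1 ∉ S → p.2 ∉ S → dExt (f p.1 p.2) (g p.1 p.2) ≤ ε}

/-- The box distance of two qmm-spaces. -/
def boxDist {Y : Type*} [MeasurableSpace Y] [StandardBorelSpace Y]
    (P : QMMSpace X) (Q : QMMSpace Y) : ℝ≥0∞ :=
  ⨅ (Ψ₁ : P.MPM) (Ψ₂ : Q.MPM), box (P.pullback Ψ₁) (Q.pullback Ψ₂)

end QMMSpace

end

/-! Equal sampling measures imply isomorphic pull-backs: fix a sequence c of i.i.d. anchors and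
attach to a random point x its row r, the independent lengths r_l with law d(x, c_l). Applied to the
pairs (c_l, r_l), the law of large numbers reads off from r the integrals of z ↦ d(x, z)(B) over a
countable π-system of sets (`ae_frequencyProfile_eq`). Because d is symmetric, these integrals at x
and at y determine d(x, y)(B) for almost all (x, y) (`exists_eq_comp_sectionProfile`). Hence, for
almost every c, d(x, y)(B) = W(r, r') almost everywhere, where r, r' are the rows of x, y and W may
depend on c (`ae_exists_d_eq_comp_rows`).

It remains to find anchors c in X and c' in Y that can be compared. The pair masses of c record the
joint law of the two rows and the length between two fresh random points. Their mixed moments over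
random c are probabilities of events on a single sampled matrix (`lintegral_prod_pairMass`), so τ
determines the law of the pair masses (`map_pairMassVector_eq`). A coupling then yields generic c,
c' with equal pair masses. The rows have the same law for both, and the two functions W agree almost
everywhere (`ae_eq_of_pairMass_eq`). Gluing the two laws of (point, row) along the row gives a
measure under which both distances are the same function of the rows; it is an image of Lebesgue
measure on [0,1].

Conversely, joint moments determine a sampling law. Transported to i.i.d. points of [0,1], the
moments of the two spaces differ by at most a constant times ε whenever the pull-backs are ε-close
in the box sense (`abs_integral_prod_pow_sub_le`). -/

open ProbabilityTheory Filter Topology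

/-! ### Countable π-systems, couplings, and i.i.d. sequences. -/

section General

/-- Finite intersections of the sets of a fixed countable generating sequence. -/
def genInter (α : Type*) [MeasurableSpace α] [MeasurableSpace.CountablyGenerated α]
    (s : Finset ℕ) : Set α :=
  ⋂ i ∈ s, MeasurableSpace.natGeneratingSequence α i

section genInter

variable {α : Type*} [MeasurableSpace α] [MeasurableSpace.CountablyGenerated α]

theorem genInter_empty : genInter α ∅ = Set.univ := by simp [genInter]

theorem genInter_union (s t : Finset ℕ) :
    genInter α (s ∪ t) = genInter α s ∩ genInter α t := by
  ext x
  simp only [genInter, Set.mem_iInter, Set.mem_inter_iff, Finset.mem_union]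
  grind

theorem measurableSet_genInter (s : Finset ℕ) : MeasurableSet (genInter α s) :=
  Finset.measurableSet_biInter _ fun _ _ => MeasurableSpace.measurableSet_natGeneratingSequence _

theorem isPiSystem_range_genInter : IsPiSystem (Set.range (genInter α)) := by
  rintro _ ⟨s, rfl⟩ _ ⟨t, rfl⟩ -
  exact ⟨s ∪ t, genInter_union s t⟩

theorem generateFrom_range_genInter :
    MeasurableSpace.generateFrom (Set.range (genInter α)) = ‹MeasurableSpace α› := by
  apply le_antisymm
  · exact MeasurableSpace.generateFrom_le (by rintro _ ⟨s, rfl⟩; exact measurableSet_genInter s)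
  · conv_lhs => rw [← MeasurableSpace.generateFrom_natGeneratingSequence α]
    refine MeasurableSpace.generateFrom_mono ?_
    rintro _ ⟨i, rfl⟩
    exact ⟨{i}, by simp [genInter]⟩

theorem measure_ext_genInter {μ ν : Measure α} [IsFiniteMeasure μ]
    (h : ∀ s, μ (genInter α s) = ν (genInter α s)) : μ = ν := by
  refine ext_of_generate_finite _ generateFrom_range_genInter.symm isPiSystem_range_genInter ?_ ?_
  · rintro _ ⟨s, rfl⟩
    exact h s
  · simpa [genInter_empty] using h ∅

theorem ae_eq_of_setLIntegral_genInter {μ : Measure α} [IsFiniteMeasure μ] {f g : α → ℝ≥0∞}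
    (hf : Measurable f) (hg : Measurable g) (hf' : ∫⁻ x, f x ∂μ ≠ ∞)
    (h : ∀ s, ∫⁻ x in genInter α s, f x ∂μ = ∫⁻ x in genInter α s, g x ∂μ) : f =ᵐ[μ] g := by
  have := isFiniteMeasure_withDensity hf'
  refine (withDensity_eq_iff hf.aemeasurable hg.aemeasurable hf').1 (measure_ext_genInter ?_)
  intro s
  rw [withDensity_apply _ (measurableSet_genInter s), withDensity_apply _ (measurableSet_genInter s),
    h]

end genInter

/-- The graph of θ carries the joint law of θ and the identity, so the disintegration of ξ along θ
lives on the fibres of θ. -/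
theorem ae_condDistrib_id_eq {W Z : Type*} [MeasurableSpace W] [StandardBorelSpace W] [Nonempty W]
    [MeasurableSpace Z] [MeasurableEq Z] (ξ : Measure W) [IsProbabilityMeasure ξ] {θ : W → Z}
    (hθ : Measurable θ) : ∀ᵐ t ∂(ξ.map θ), ∀ᵐ w ∂(condDistrib id θ ξ t), θ w = t := by
  refine Measure.ae_ae_of_ae_compProd (p := fun q : Z × W => θ q.2 = q.1) ?_
  rw [compProd_map_condDistrib aemeasurable_id,
    ae_map_iff (by fun_prop) (measurableSet_eq_fun (by fun_prop) (by fun_prop))]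
  simp

/-- The relatively independent coupling: draw z from the common image, then draw the two points
independently from the conditional laws over z. It is used twice, to match anchors with equal pair
masses and to match points with equal rows. -/
theorem exists_coupling_of_map_eq {X Y Z : Type*} [MeasurableSpace X] [StandardBorelSpace X]
    [MeasurableSpace Y] [StandardBorelSpace Y] [MeasurableSpace Z] [MeasurableEq Z]
    (μ : Measure X) [IsProbabilityMeasure μ] (ν : Measure Y) [IsProbabilityMeasure ν]
    {φ : X → Z} {ψ : Y → Z} (hφ : Measurable φ) (hψ : Measurable ψ) (h : μ.map φ = ν.map ψ) :
    ∃ π : Measure (X × Y), IsProbabilityMeasure π ∧ π.map Prod.fst = μ ∧ π.map Prod.snd = ν ∧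
      ∀ᵐ p ∂π, φ p.1 = ψ p.2 := by
  have : Nonempty X := nonempty_of_isProbabilityMeasure μ
  have : Nonempty Y := nonempty_of_isProbabilityMeasure ν
  have : IsProbabilityMeasure (μ.map φ) := Measure.isProbabilityMeasure_map hφ.aemeasurable
  refine ⟨(condDistrib id φ μ ×ₖ condDistrib id ψ ν) ∘ₘ (μ.map φ), inferInstance, ?_, ?_, ?_⟩
  · rw [Measure.map_comp _ _ measurable_fst, ← Kernel.fst_eq, Kernel.fst_prod,
      condDistrib_comp_map hφ.aemeasurable aemeasurable_id, Measure.map_id]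
  · rw [Measure.map_comp _ _ measurable_snd, ← Kernel.snd_eq, Kernel.snd_prod, h,
      condDistrib_comp_map hψ.aemeasurable aemeasurable_id, Measure.map_id]
  · refine Measure.ae_comp_of_ae_ae (measurableSet_eq_fun (by fun_prop) (by fun_prop)) ?_
    filter_upwards [ae_condDistrib_id_eq μ hφ, h ▸ ae_condDistrib_id_eq ν hψ] with t h1 h2
    rw [Kernel.prod_apply]
    have h1' := Measure.quasiMeasurePreserving_fst (μ := condDistrib id φ μ t)
      (ν := condDistrib id ψ ν t) |>.ae h1
    have h2' := Measure.quasiMeasurePreserving_snd (μ := condDistrib id φ μ t)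
      (ν := condDistrib id ψ ν t) |>.ae h2
    filter_upwards [h1', h2'] with p hp1 hp2
    rw [hp1, hp2]

/-- Resampling one coordinate of an i.i.d. sequence does not change its law; this is the device for
integrating out single points. -/
theorem measurePreserving_update {X : Type*} [MeasurableSpace X] (μ : Measure X)
    [IsProbabilityMeasure μ] (n : ℕ) :
    MeasurePreserving (fun p : (ℕ → X) × X => Function.update p.1 n p.2)
      ((Measure.infinitePi fun _ : ℕ => μ).prod μ) (Measure.infinitePi fun _ : ℕ => μ) := by
  have hm : Measurable (fun p : (ℕ → X) × X => Function.update p.1 n p.2) := by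
    refine measurable_pi_iff.2 fun i => ?_
    by_cases h : i = n
    · subst h; simpa using measurable_snd
    · simp only [Function.update_of_ne h]; fun_prop
  refine ⟨hm, Measure.eq_infinitePi _ fun s t ht => ?_⟩
  have hs : MeasurableSet (Set.pi (s : Set ℕ) t) := .pi s.countable_toSet fun i _ => ht i
  rw [Measure.map_apply hm hs]
  have : (fun p : (ℕ → X) × X => Function.update p.1 n p.2) ⁻¹' Set.pi (s : Set ℕ) t =
      Set.pi ((s.erase n : Finset ℕ) : Set ℕ) t ×ˢ (if n ∈ s then t n else Set.univ) := by
    ext ⟨x, y⟩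
    simp only [Set.mem_preimage, Set.mem_pi, Finset.mem_coe, Set.mem_prod, Finset.mem_erase]
    constructor
    · intro h
      refine ⟨fun i hi => by simpa [hi.1] using h i hi.2, ?_⟩
      split_ifs with hn
      · simpa using h n hn
      · trivial
    · rintro ⟨h1, h2⟩ i hi
      by_cases hin : i = n
      · subst hin; simpa [hi] using h2
      · simpa [hin] using h1 i ⟨hin, hi⟩
  rw [this, Measure.prod_prod, Measure.infinitePi_pi _ fun i _ => ht i]
  split_ifs with hn
  · exact Finset.prod_erase_mul s (fun i => μ (t i)) hn
  · simp [hn]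

theorem ae_tendsto_average_infinitePi {Ω : Type*} [MeasurableSpace Ω] (P : Measure Ω)
    [IsProbabilityMeasure P] {h : Ω → ℝ} (hm : Measurable h) (hi : Integrable h P) :
    ∀ᵐ ω ∂(Measure.infinitePi fun _ : ℕ => P),
      Tendsto (fun n : ℕ => (∑ i ∈ Finset.range n, h (ω i)) / n) atTop (𝓝 (∫ x, h x ∂P)) := by
  have hmp : ∀ i, MeasurePreserving (fun ω : ℕ → Ω => ω i) (Measure.infinitePi fun _ : ℕ => P) P :=
    fun i => measurePreserving_eval_infinitePi (fun _ : ℕ => P) i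
  have hind := iIndepFun_infinitePi (P := fun _ : ℕ => P) (X := fun _ => h) (fun _ => hm)
  have := strong_law_ae_real (μ := Measure.infinitePi fun _ : ℕ => P) (fun i ω => h (ω i))
    ((hmp 0).integrable_comp_of_integrable hi) (fun i j hij => hind.indepFun hij) (fun i => by
      refine ⟨(hm.comp (hmp i).measurable).aemeasurable, (hm.comp (hmp 0).measurable).aemeasurable, ?_⟩
      rw [show (fun ω : ℕ → Ω => h (ω i)) = h ∘ (fun ω => ω i) from rfl,
        show (fun ω : ℕ → Ω => h (ω 0)) = h ∘ (fun ω => ω 0) from rfl,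
        ← Measure.map_map hm (hmp i).measurable, ← Measure.map_map hm (hmp 0).measurable,
        (hmp i).map_eq, (hmp 0).map_eq])
  rwa [show ∫ ω, h (ω 0) ∂(Measure.infinitePi fun _ : ℕ => P) = ∫ x, h x ∂P from by
    rw [← (hmp 0).map_eq, integral_map (hmp 0).measurable.aemeasurable
      hm.aestronglyMeasurable, (hmp 0).map_eq]] at this

end General

/-! ### Kernels of infinite products. -/

section InfiniteProducts

/-- The kernel whose value at `a` is the product of the measures `κ i a`. -/
noncomputable def infinitePiKernel {A Y ι : Type*} [MeasurableSpace A] [MeasurableSpace Y]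
    (κ : ι → Kernel A Y) [∀ i, IsMarkovKernel (κ i)] : Kernel A (ι → Y) where
  toFun a := Measure.infinitePi fun i => κ i a
  measurable' := by
    refine Measurable.measure_of_isPiSystem_of_isProbabilityMeasure
      generateFrom_squareCylinders.symm
      (isPiSystem_squareCylinders (fun _ => MeasurableSpace.isPiSystem_measurableSet) (by simp)) ?_
    rintro _ ⟨s, t, ht, rfl⟩
    have ht' : ∀ p, MeasurableSet (t p) := fun p => ht p (Set.mem_univ p)
    simp_rw [Measure.infinitePi_pi _ fun p _ => ht' p]
    exact Finset.measurable_prod _ fun p _ => Kernel.measurable_coe _ (ht' p)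

variable {A X Y ι : Type*} [MeasurableSpace A] [MeasurableSpace X] [MeasurableSpace Y]

theorem infinitePiKernel_apply (κ : ι → Kernel A Y) [∀ i, IsMarkovKernel (κ i)] (a : A) :
    infinitePiKernel κ a = Measure.infinitePi fun i => κ i a := rfl

instance (κ : ι → Kernel A Y) [∀ i, IsMarkovKernel (κ i)] : IsMarkovKernel (infinitePiKernel κ) :=
  ⟨fun a => by rw [infinitePiKernel_apply]; infer_instance⟩

/-- Sampling an i.i.d. sequence `c` and then independent `r l` with law `κ (c l)` amounts to
sampling an i.i.d. sequence of pairs. -/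
theorem map_zip_infinitePi_compProd (μ : Measure X) [IsProbabilityMeasure μ] (κ : Kernel X Y)
    [IsMarkovKernel κ] :
    ((Measure.infinitePi fun _ : ℕ => μ) ⊗ₘ
        infinitePiKernel fun l : ℕ => κ.comap (fun c : ℕ → X => c l) (measurable_pi_apply l)).map
      (fun q l => (q.1 l, q.2 l)) = Measure.infinitePi fun _ : ℕ => μ ⊗ₘ κ := by
  refine Measure.eq_infinitePi _ fun s t ht => ?_
  have hm : Measurable fun (q : (ℕ → X) × (ℕ → Y)) (l : ℕ) => (q.1 l, q.2 l) := by fun_prop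
  have hs : MeasurableSet (Set.pi (s : Set ℕ) t) := .pi s.countable_toSet fun i _ => ht i
  rw [Measure.map_apply hm hs, Measure.compProd_apply (hm hs)]
  have h1 : ∀ c : ℕ → X, (infinitePiKernel fun l : ℕ =>
      κ.comap (fun c : ℕ → X => c l) (measurable_pi_apply l)) c
        (Prod.mk c ⁻¹' ((fun q l => (q.1 l, q.2 l)) ⁻¹' Set.pi (s : Set ℕ) t)) =
      ∏ l ∈ s, κ (c l) (Prod.mk (c l) ⁻¹' t l) := by
    intro c
    have : Prod.mk c ⁻¹' ((fun (q : (ℕ → X) × (ℕ → Y)) l => (q.1 l, q.2 l)) ⁻¹'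
        Set.pi (s : Set ℕ) t) = Set.pi (s : Set ℕ) fun l => Prod.mk (c l) ⁻¹' t l := by
      ext r; simp [Set.mem_pi]
    rw [this, infinitePiKernel_apply, Measure.infinitePi_pi _ fun l _ => measurable_prodMk_left (ht l)]
    rfl
  simp_rw [h1]
  have hmk : ∀ l, Measurable fun x => κ x (Prod.mk x ⁻¹' t l) := fun l =>
    Kernel.measurable_kernel_prodMk_left (ht l)
  rw [lintegral_prod_eq_prod_lintegral_of_indepFun s
    (fun l (c : ℕ → X) => κ (c l) (Prod.mk (c l) ⁻¹' t l))
    (iIndepFun_infinitePi (P := fun _ : ℕ => μ) hmk) (fun l => (hmk l).comp (measurable_pi_apply l))]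
  refine Finset.prod_congr rfl fun l _ => ?_
  rw [Measure.compProd_apply (ht l),
    ← (measurePreserving_eval_infinitePi (fun _ : ℕ => μ) l).lintegral_comp (hmk l)]

end InfiniteProducts

/-! ### The moment problem on a cube. -/

section Moments

open BoundedContinuousFunction

/-- Finite measures on a countable power of the unit interval are determined by their joint
moments. -/
theorem measure_ext_of_moments {ι : Type*} [Countable ι] [Nonempty ι] {μ ν : Measure (ι → I)}
    [IsFiniteMeasure μ] [IsFiniteMeasure ν]
    (h : ∀ (K : ℕ) (e : ℕ → ι), ∫ x, ∏ k ∈ Finset.range K, (x (e k) : ℝ) ∂μ =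
      ∫ x, ∏ k ∈ Finset.range K, (x (e k) : ℝ) ∂ν) : μ = ν := by
  let coord : ι → ((ι → I) →ᵇ ℝ) := fun i => mkOfCompact ⟨fun x => (x i : ℝ), by fun_prop⟩
  have hmon : ∀ f ∈ Submonoid.closure (Set.range coord), ∃ (K : ℕ) (e : ℕ → ι),
      ∀ x, f x = ∏ k ∈ Finset.range K, (x (e k) : ℝ) := by
    intro f hf
    induction hf using Submonoid.closure_induction with
    | mem f hf =>
      obtain ⟨i, rfl⟩ := hf
      exact ⟨1, fun _ => i, fun x => by simp [coord]⟩
    | one => exact ⟨0, fun _ => Classical.arbitrary ι, fun x => by simp⟩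
    | mul f g _ _ hf hg =>
      obtain ⟨K, e, he⟩ := hf
      obtain ⟨K', e', he'⟩ := hg
      refine ⟨K + K', fun k => if k < K then e k else e' (k - K), fun x => ?_⟩
      rw [Finset.prod_range_add, BoundedContinuousFunction.mul_apply, he, he']
      congr 1
      · exact Finset.prod_congr rfl fun k hk => by simp [Finset.mem_range.1 hk]
      · simp
  let A : StarSubalgebra ℝ ((ι → I) →ᵇ ℝ) :=
    { Algebra.adjoin ℝ (Set.range coord) with
      star_mem' := fun {f} hf => by
        have : star f = f := by ext; simp
        rwa [this] }
  -- The coordinates separate points, so the algebra they generate determines the measure; that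
  -- algebra is the linear span of the monomials.
  refine ext_of_forall_mem_subalgebra_integral_eq_of_polish (A := A) ?_ ?_
  · intro x y hxy
    obtain ⟨i, hi⟩ := Function.ne_iff.1 hxy
    refine ⟨_, ⟨toContinuousMapStarₐ ℝ (coord i), ⟨coord i, ?_, rfl⟩, rfl⟩, ?_⟩
    · exact Algebra.subset_adjoin ⟨i, rfl⟩
    · simpa [coord, Subtype.ext_iff] using hi
  · intro g hg
    have hg' : g ∈ Submodule.span ℝ (Submonoid.closure (Set.range coord) : Set ((ι → I) →ᵇ ℝ)) := by
      rw [← Algebra.adjoin_eq_span]; exact hg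
    clear hg
    induction hg' using Submodule.span_induction with
    | mem f hf =>
      obtain ⟨K, e, he⟩ := hmon f hf
      simp_rw [he]
      exact h K e
    | zero => simp
    | add f g hf' hg' hf hg =>
      simp only [BoundedContinuousFunction.add_apply]
      rw [integral_add (f.integrable _) (g.integrable _), integral_add (f.integrable _)
        (g.integrable _), hf, hg]
    | smul c f hf' hf =>
      simp only [BoundedContinuousFunction.coe_smul, integral_smul, hf]

end Moments

/-! ### Symmetric functions and the profiles of their sections. -/

section SymmetricKernel

theorem measurableSet_setOf_ae {A Z : Type*} [MeasurableSpace A] [MeasurableSpace Z]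
    (μ : Measure Z) [SFinite μ] {p : A × Z → Prop} (hp : MeasurableSet {q | p q}) :
    MeasurableSet {a | ∀ᵐ z ∂μ, p (a, z)} :=
  measurable_measure_prodMk_left hp.compl (measurableSet_singleton 0)

variable {X : Type*} [MeasurableSpace X] [StandardBorelSpace X]

/-- The integrals of the section `F x` over the sets of a countable generating `π`-system. -/
noncomputable def sectionProfile (μ : Measure X) (F : X → X → ℝ≥0∞) (x : X) (s : Finset ℕ) : ℝ≥0∞ :=
  ∫⁻ z in genInter X s, F x z ∂μ

theorem measurable_sectionProfile (μ : Measure X) [SFinite μ] {F : X → X → ℝ≥0∞}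
    (hF : Measurable (Function.uncurry F)) : Measurable (sectionProfile μ F) :=
  measurable_pi_iff.2 fun _ => hF.lintegral_prod_right' (ν := μ.restrict _)

/-- A bounded symmetric function of two variables factors almost everywhere through the profiles
of its sections. -/
theorem exists_eq_comp_sectionProfile (μ : Measure X) [IsProbabilityMeasure μ]
    {F : X → X → ℝ≥0∞} (hF : Measurable (Function.uncurry F)) (hF1 : ∀ x z, F x z ≤ 1)
    (hsymm : ∀ x z, F x z = F z x) :
    ∃ W : (Finset ℕ → ℝ≥0∞) → (Finset ℕ → ℝ≥0∞) → ℝ≥0∞, Measurable (Function.uncurry W) ∧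
      ∀ᵐ p ∂(μ.prod μ), F p.1 p.2 = W (sectionProfile μ F p.1) (sectionProfile μ F p.2) := by
  have : Nonempty X := nonempty_of_isProbabilityMeasure μ
  set T := sectionProfile μ F with hTdef
  have hT : Measurable T := measurable_sectionProfile μ hF
  have : IsProbabilityMeasure (μ.map T) := Measure.isProbabilityMeasure_map hT.aemeasurable
  set κ := condDistrib id T μ
  have hdis : (μ.map T) ⊗ₘ κ = μ.map (fun x => (T x, x)) := compProd_map_condDistrib aemeasurable_id
  have hF' : Measurable fun p : X × X => F p.1 p.2 := hF
  -- The average of the sections F x over the points x of profile t, since κ t is μ conditioned on T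
  -- = t.
  let U : (Finset ℕ → ℝ≥0∞) → X → ℝ≥0∞ := fun t z => ∫⁻ x, F x z ∂(κ t)
  have hU : Measurable fun p : (Finset ℕ → ℝ≥0∞) × X => U p.1 p.2 := by
    have := Measurable.lintegral_kernel_prod_right' (κ := κ.comap Prod.fst measurable_fst)
      (f := fun q : ((Finset ℕ → ℝ≥0∞) × X) × X => F q.2 q.1.2) (by fun_prop)
    exact this
  -- A section is determined almost everywhere by its profile, so on the fibre over t every section
  -- coincides with the average U t.
  have hFU : ∀ᵐ t ∂(μ.map T), ∀ᵐ x ∂(κ t), ∀ᵐ z ∂μ, F x z = U t z := by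
    filter_upwards [ae_condDistrib_id_eq μ hT] with t ht
    have hUt : ∀ s, ∫⁻ z in genInter X s, U t z ∂μ = t s := by
      intro s
      rw [lintegral_lintegral_swap (by fun_prop)]
      calc ∫⁻ x, T x s ∂(κ t) = ∫⁻ x, t s ∂(κ t) := by
            refine lintegral_congr_ae ?_
            filter_upwards [ht] with x hx
            rw [hx]
        _ = t s := by simp
    filter_upwards [ht] with x hx
    refine ae_eq_of_setLIntegral_genInter (by fun_prop) (by fun_prop) ?_ fun s => ?_
    · exact ne_top_of_le_ne_top ENNReal.one_ne_top
        ((lintegral_mono fun z => hF1 x z).trans (by simp))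
    · rw [hUt, ← hx]; rfl
  -- Drawing t and then x from κ t is the same as drawing x from μ and setting t = T x.
  have hsame : ∀ {p : (Finset ℕ → ℝ≥0∞) → X → X → Prop},
      MeasurableSet {q : ((Finset ℕ → ℝ≥0∞) × X) × X | p q.1.1 q.1.2 q.2} →
      ((∀ᵐ t ∂(μ.map T), ∀ᵐ x ∂(κ t), ∀ᵐ z ∂μ, p t x z) ↔ ∀ᵐ q ∂(μ.prod μ), p (T q.1) q.1 q.2) := by
    intro p hp
    have hp1 : MeasurableSet {q : (Finset ℕ → ℝ≥0∞) × X | ∀ᵐ z ∂μ, p q.1 q.2 z} :=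
      measurableSet_setOf_ae μ (p := fun q : ((Finset ℕ → ℝ≥0∞) × X) × X => p q.1.1 q.1.2 q.2) hp
    have e1 := Measure.ae_compProd_iff (μ := μ.map T) (κ := κ)
      (p := fun q : (Finset ℕ → ℝ≥0∞) × X => ∀ᵐ z ∂μ, p q.1 q.2 z) hp1
    rw [← e1, hdis, ae_map_iff (by fun_prop) hp1]
    rw [Measure.ae_prod_iff_ae_ae]
    exact hp.preimage (f := fun q : X × X => ((T q.1, q.1), q.2)) (by fun_prop)
  have hT' : Measurable fun x => T x := hT
  have h1 : ∀ᵐ q ∂(μ.prod μ), F q.1 q.2 = U (T q.1) q.2 :=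
    (hsame (measurableSet_eq_fun (by fun_prop) (by fun_prop))).1 hFU
  have h2 : ∀ᵐ q ∂(μ.prod μ), F q.1 q.2 = U (T q.2) q.1 := by
    have := (Measure.measurePreserving_swap (μ := μ) (ν := μ)).quasiMeasurePreserving.ae h1
    filter_upwards [this] with q hq
    rw [hsymm]; exact hq
  -- Symmetry enters here: F x z depends on x only through T x and on z only through T z. Averaging
  -- this identity over x in the fibre removes x and leaves a function of the two profiles.
  have h3 : ∀ᵐ t ∂(μ.map T), ∀ᵐ x ∂(κ t), ∀ᵐ z ∂μ, U (T z) x = U t z := by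
    refine (hsame (measurableSet_eq_fun (by fun_prop) (by fun_prop))).2 ?_
    filter_upwards [h1, h2] with q hq1 hq2
    rw [← hq1, hq2]
  refine ⟨fun t t' => ∫⁻ x, U t' x ∂(κ t), ?_, ?_⟩
  · exact Measurable.lintegral_kernel_prod_right' (κ := κ.comap Prod.fst measurable_fst)
      (f := fun q : ((Finset ℕ → ℝ≥0∞) × (Finset ℕ → ℝ≥0∞)) × X => U q.1.2 q.2) (by fun_prop)
  · have h4 : ∀ᵐ t ∂(μ.map T), ∀ᵐ x ∂(κ t), ∀ᵐ z ∂μ, U t z = ∫⁻ x, U (T z) x ∂(κ t) := by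
      filter_upwards [h3] with t ht
      refine ae_of_all _ fun _ => ?_
      replace ht := (Measure.ae_ae_comm (p := fun x z => U (T z) x = U t z)
        (measurableSet_eq_fun (by fun_prop) (by fun_prop))).1 ht
      filter_upwards [ht] with z hz
      rw [lintegral_congr_ae hz]
      simp
    have hW : Measurable fun q : ((Finset ℕ → ℝ≥0∞) × X) × X => ∫⁻ x, U (T q.2) x ∂(κ q.1.1) :=
      Measurable.lintegral_kernel_prod_right'
        (κ := κ.comap (fun q : ((Finset ℕ → ℝ≥0∞) × X) × X => q.1.1) (by fun_prop))
        (f := fun q : (((Finset ℕ → ℝ≥0∞) × X) × X) × X => U (T q.1.2) q.2) (by fun_prop)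
    have h5 := (hsame (p := fun t _ z => U t z = ∫⁻ x, U (T z) x ∂(κ t))
      (measurableSet_eq_fun (by fun_prop) hW)).1 h4
    filter_upwards [h1, h5] with q hq1 hq5
    rw [hq1, hq5]

end SymmetricKernel

namespace QMMSpace

/-! ### Rows of random lengths to the anchors. -/

section Rows

variable {X : Type*} [MeasurableSpace X] [StandardBorelSpace X] (Q : QMMSpace X)

/-- The distance function as a Markov kernel. -/
noncomputable def dKernel : Kernel (X × X) I where
  toFun p := Q.d p.1 p.2
  measurable' := measurable_subtype_coe.comp Q.measurable_d

instance : IsMarkovKernel Q.dKernel :=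
  ⟨fun p => inferInstanceAs (IsProbabilityMeasure (Q.d p.1 p.2 : Measure I))⟩

theorem measurable_d_apply {B : Set I} (hB : MeasurableSet B) :
    Measurable fun p : X × X => (Q.d p.1 p.2 : Measure I) B :=
  Q.dKernel.measurable_coe hB

/-- The law of the random lengths between a point `x` and the anchors `c`. -/
noncomputable def rowKernel : Kernel ((ℕ → X) × X) (ℕ → I) :=
  infinitePiKernel fun l => Q.dKernel.comap (fun q => (q.2, q.1 l)) (by fun_prop)

instance : IsMarkovKernel Q.rowKernel := by unfold rowKernel; infer_instance

theorem rowKernel_apply (c : ℕ → X) (x : X) :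
    Q.rowKernel (c, x) = Measure.infinitePi fun l => (Q.d x (c l) : Measure I) := rfl

/-- The joint law of a random point and its random lengths to the anchors `c`. -/
noncomputable def rowLaw (c : ℕ → X) : Measure (X × (ℕ → I)) :=
  (Q.μ : Measure X) ⊗ₘ Q.rowKernel.comap (fun x => (c, x)) (by fun_prop)

instance (c : ℕ → X) : IsProbabilityMeasure (Q.rowLaw c) := by unfold rowLaw; infer_instance

theorem map_fst_rowLaw (c : ℕ → X) : (Q.rowLaw c).map Prod.fst = Q.μ :=
  Measure.fst_compProd _ _

/-- The law of an i.i.d. sequence of points. -/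
noncomputable abbrev anchorLaw : Measure (ℕ → X) := Measure.infinitePi fun _ : ℕ => (Q.μ : Measure X)

end Rows

/-! ### Recovering distances from rows. -/

section Recovery

variable {X : Type*} [MeasurableSpace X] [StandardBorelSpace X]

/-- The asymptotic frequencies, for the sets `A` of a countable generating `π`-system, of the
indices `l` with `c l ∈ A` and `r l ∈ B`. -/
noncomputable def frequencyProfile (B : Set I) (c : ℕ → X) (r : ℕ → I) (s : Finset ℕ) : ℝ≥0∞ :=
  -- An upper limit is defined and measurable everywhere, also where the frequencies fail to
  -- converge.
  limsup (fun n : ℕ => ENNReal.ofReal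
    ((∑ l ∈ Finset.range n, (genInter X s ×ˢ B).indicator (fun _ => (1 : ℝ)) (c l, r l)) / n)) atTop

theorem measurable_frequencyProfile {B : Set I} (hB : MeasurableSet B) :
    Measurable fun q : (ℕ → X) × (ℕ → I) => frequencyProfile B q.1 q.2 := by
  refine measurable_pi_iff.2 fun s => Measurable.limsup fun n => ?_
  refine ENNReal.measurable_ofReal.comp (Measurable.div_const (Finset.measurable_sum _ fun l _ => ?_) _)
  exact (measurable_const.indicator ((measurableSet_genInter s).prod hB)).comp (by fun_prop)

variable (Q : QMMSpace X)

/-- For fixed x the pairs (c l, r l) are i.i.d., and the probability that c l ∈ A and r l ∈ B is the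
integral of z ↦ d(x, z)(B) over A. The strong law applies simultaneously to the countably many sets
A. -/
theorem ae_frequencyProfile_eq {B : Set I} (hB : MeasurableSet B) (x : X) :
    ∀ᵐ c ∂Q.anchorLaw, ∀ᵐ r ∂(Q.rowKernel (c, x)),
      frequencyProfile B c r = sectionProfile Q.μ (fun x z => (Q.d x z : Measure I) B) x := by
  set κ : Kernel X I := Q.dKernel.comap (fun z => (x, z)) (by fun_prop) with hκ
  have hAB : ∀ s, MeasurableSet (genInter X s ×ˢ B) := fun s => (measurableSet_genInter s).prod hB
  have hlln : ∀ᵐ ω ∂(Measure.infinitePi fun _ : ℕ => (Q.μ : Measure X) ⊗ₘ κ),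
      frequencyProfile B (fun l => (ω l).1) (fun l => (ω l).2) =
        sectionProfile Q.μ (fun x z => (Q.d x z : Measure I) B) x := by
    have : ∀ᵐ ω ∂(Measure.infinitePi fun _ : ℕ => (Q.μ : Measure X) ⊗ₘ κ), ∀ s : Finset ℕ,
        Tendsto (fun n : ℕ => (∑ i ∈ Finset.range n,
          (genInter X s ×ˢ B).indicator (fun _ => (1 : ℝ)) (ω i)) / n) atTop
          (𝓝 (∫ q, (genInter X s ×ˢ B).indicator (fun _ => (1 : ℝ)) q ∂((Q.μ : Measure X) ⊗ₘ κ))) :=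
      ae_all_iff.2 fun s => ae_tendsto_average_infinitePi _
        (measurable_const.indicator (hAB s)) ((integrable_const _).indicator (hAB s))
    filter_upwards [this] with ω hω
    funext s
    refine ((ENNReal.continuous_ofReal.tendsto _).comp (hω s)).limsup_eq.trans ?_
    rw [integral_indicator (hAB s), setIntegral_const, smul_eq_mul, mul_one, measureReal_def,
      ENNReal.ofReal_toReal (measure_ne_top _ _),
      Measure.compProd_apply_prod (measurableSet_genInter s) hB]
    rfl
  rw [← map_zip_infinitePi_compProd] at hlln
  have h1 := ae_of_ae_map (by fun_prop) hlln
  have h2 := Measure.ae_ae_of_ae_compProd (p := fun q : (ℕ → X) × (ℕ → I) =>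
    frequencyProfile B q.1 q.2 = sectionProfile Q.μ (fun x z => (Q.d x z : Measure I) B) x) h1
  filter_upwards [h2] with c hc
  exact hc

/-- For almost all anchors `c`, the random lengths to the anchors determine the distances. -/
theorem ae_exists_d_eq_comp_rows {B : Set I} (hB : MeasurableSet B) :
    ∀ᵐ c ∂Q.anchorLaw, ∃ W : (ℕ → I) → (ℕ → I) → ℝ≥0∞, Measurable (Function.uncurry W) ∧
      ∀ᵐ p ∂((Q.rowLaw c).prod (Q.rowLaw c)),
        (Q.d p.1.1 p.2.1 : Measure I) B = W p.1.2 p.2.2 := by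
  obtain ⟨W, hW, hWae⟩ := exists_eq_comp_sectionProfile (Q.μ : Measure X)
    (F := fun x z => (Q.d x z : Measure I) B) (Q.measurable_d_apply hB) (fun _ _ => prob_le_one)
    (fun x z => by rw [Q.d_symm])
  set T := sectionProfile (Q.μ : Measure X) fun x z => (Q.d x z : Measure I) B
  have hT : Measurable T := measurable_sectionProfile _ (Q.measurable_d_apply hB)
  have hfr := measurable_frequencyProfile (X := X) hB
  have hset : MeasurableSet {q : ((ℕ → X) × X) × (ℕ → I) | frequencyProfile B q.1.1 q.2 = T q.1.2} :=
    measurableSet_eq_fun (hfr.comp (f := fun q : ((ℕ → X) × X) × (ℕ → I) => (q.1.1, q.2))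
      (by fun_prop)) (by fun_prop)
  have hset' : MeasurableSet {q : (ℕ → X) × X |
      ∀ᵐ r ∂(Q.rowKernel q), frequencyProfile B q.1 r = T q.2} :=
    Kernel.measurable_kernel_prodMk_left hset.compl (measurableSet_singleton 0)
  -- The exceptional set of anchors depends on x; Fubini exchanges the quantifiers so that c can be
  -- fixed once.
  have h1 : ∀ᵐ c ∂Q.anchorLaw, ∀ᵐ x ∂(Q.μ : Measure X), ∀ᵐ r ∂(Q.rowKernel (c, x)),
      frequencyProfile B c r = T x :=
    (Measure.ae_ae_comm (p := fun c x => ∀ᵐ r ∂(Q.rowKernel (c, x)), frequencyProfile B c r = T x)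
      hset').2 (ae_of_all _ fun x => Q.ae_frequencyProfile_eq hB x)
  filter_upwards [h1] with c hc
  have hfc : Measurable (frequencyProfile B c) :=
    hfr.comp (f := fun r : ℕ → I => (c, r)) (by fun_prop)
  have h2 : ∀ᵐ q ∂(Q.rowLaw c), frequencyProfile B c q.2 = T q.1 :=
    Measure.ae_compProd_of_ae_ae (measurableSet_eq_fun (by fun_prop) (by fun_prop)) hc
  refine ⟨fun r r' => W (frequencyProfile B c r) (frequencyProfile B c r'),
    hW.comp (f := fun q : (ℕ → I) × (ℕ → I) => (frequencyProfile B c q.1, frequencyProfile B c q.2))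
      (by fun_prop), ?_⟩
  have hmp : MeasurePreserving Prod.fst (Q.rowLaw c) (Q.μ : Measure X) :=
    ⟨measurable_fst, Q.map_fst_rowLaw c⟩
  filter_upwards [(hmp.prod hmp).quasiMeasurePreserving.ae hWae,
    Measure.quasiMeasurePreserving_fst.ae h2, Measure.quasiMeasurePreserving_snd.ae h2]
    with p hp hp1 hp2
  rw [hp1, hp2]
  exact hp

end Recovery

/-! ### Cylinder events for rows. -/

section Cylinders

/-- The cylinder sets of a countable generating `π`-system of `ℕ → I`. -/
def rowCylinder (a : Finset (ℕ × ℕ)) : Set (ℕ → I) :=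
  {r | ∀ q ∈ a, r q.1 ∈ MeasurableSpace.natGeneratingSequence I q.2}

/-- The `l`-th side of the cylinder `rowCylinder a`. -/
def rowCylinderSide (a : Finset (ℕ × ℕ)) (l : ℕ) : Set I :=
  {t | ∀ q ∈ a, q.1 = l → t ∈ MeasurableSpace.natGeneratingSequence I q.2}

theorem rowCylinder_eq_pi {a : Finset (ℕ × ℕ)} {L : ℕ} (hL : ∀ q ∈ a, q.1 < L) :
    rowCylinder a = Set.pi (Finset.range L : Set ℕ) (rowCylinderSide a) := by
  ext r
  simp only [rowCylinder, rowCylinderSide, Set.mem_ofPred_eq, Set.mem_pi, Finset.mem_coe,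
    Finset.mem_range]
  grind

theorem measurableSet_rowCylinderSide (a : Finset (ℕ × ℕ)) (l : ℕ) :
    MeasurableSet (rowCylinderSide a l) := by
  have : rowCylinderSide a l =
      ⋂ q ∈ a.filter (·.1 = l), MeasurableSpace.natGeneratingSequence I q.2 := by
    ext t; simp [rowCylinderSide]
  rw [this]
  exact Finset.measurableSet_biInter _ fun _ _ =>
    MeasurableSpace.measurableSet_natGeneratingSequence _

theorem measurableSet_rowCylinder (a : Finset (ℕ × ℕ)) : MeasurableSet (rowCylinder a) := by
  have : rowCylinder a = ⋂ q ∈ a, (fun r : ℕ → I => r q.1) ⁻¹'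
      MeasurableSpace.natGeneratingSequence I q.2 := by
    ext r; simp [rowCylinder]
  rw [this]
  exact Finset.measurableSet_biInter _ fun q _ =>
    measurable_pi_apply q.1 (MeasurableSpace.measurableSet_natGeneratingSequence _)

theorem rowCylinder_empty : rowCylinder ∅ = Set.univ := by simp [rowCylinder]

theorem isPiSystem_range_rowCylinder : IsPiSystem (Set.range rowCylinder) := by
  rintro _ ⟨a, rfl⟩ _ ⟨b, rfl⟩ -
  refine ⟨a ∪ b, ?_⟩
  ext r
  simp only [rowCylinder, Set.mem_ofPred_eq, Set.mem_inter_iff, Finset.mem_union]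
  grind

theorem generateFrom_range_rowCylinder :
    MeasurableSpace.generateFrom (Set.range rowCylinder) = MeasurableSpace.pi := by
  apply le_antisymm
  · exact MeasurableSpace.generateFrom_le (by rintro _ ⟨a, rfl⟩; exact measurableSet_rowCylinder a)
  · refine iSup_le fun l => ?_
    conv_lhs => rw [← MeasurableSpace.generateFrom_natGeneratingSequence I,
      MeasurableSpace.comap_generateFrom]
    refine MeasurableSpace.generateFrom_mono ?_
    rintro _ ⟨_, ⟨i, rfl⟩, rfl⟩
    exact ⟨{(l, i)}, by ext r; simp [rowCylinder]⟩

theorem measure_ext_rowCylinder {μ ν : Measure (ℕ → I)} [IsFiniteMeasure μ]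
    (h : ∀ a, μ (rowCylinder a) = ν (rowCylinder a)) : μ = ν := by
  refine ext_of_generate_finite _ generateFrom_range_rowCylinder.symm
    isPiSystem_range_rowCylinder ?_ ?_
  · rintro _ ⟨a, rfl⟩
    exact h a
  · simpa [rowCylinder_empty] using h ∅

theorem measure_ext_rowCylinder_prod {μ ν : Measure ((ℕ → I) × (ℕ → I))} [IsFiniteMeasure μ]
    (h : ∀ a b, μ (rowCylinder a ×ˢ rowCylinder b) = ν (rowCylinder a ×ˢ rowCylinder b)) :
    μ = ν := by
  have hspan : IsCountablySpanning (Set.range rowCylinder) :=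
    ⟨fun _ => Set.univ, fun _ => ⟨∅, rowCylinder_empty⟩, Set.iUnion_const _⟩
  refine ext_of_generate_finite _
    (generateFrom_eq_prod generateFrom_range_rowCylinder generateFrom_range_rowCylinder
      hspan hspan).symm (isPiSystem_range_rowCylinder.prod isPiSystem_range_rowCylinder) ?_ ?_
  · rintro _ ⟨_, ⟨a, rfl⟩, _, ⟨b, rfl⟩, rfl⟩
    exact h a b
  · simpa [rowCylinder_empty] using h ∅ ∅

end Cylinders

end QMMSpace

/-! ### Integrating out disjoint pairs of points. -/

section IntegrateOut

variable {X : Type*} [MeasurableSpace X] (μ : Measure X) [IsProbabilityMeasure μ]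

theorem lintegral_infinitePi_update_update (m n : ℕ) {G : (ℕ → X) → ℝ≥0∞} (hG : Measurable G) :
    ∫⁻ x, G x ∂(Measure.infinitePi fun _ : ℕ => μ) =
      ∫⁻ x, ∫⁻ p : X × X, G (Function.update (Function.update x m p.1) n p.2) ∂(μ.prod μ)
        ∂(Measure.infinitePi fun _ : ℕ => μ) := by
  have hm := measurePreserving_update μ m
  have hn := measurePreserving_update μ n
  have hupd : Measurable fun q : (ℕ → X) × X => G (Function.update q.1 n q.2) :=
    hG.comp hn.measurable
  have hin : Measurable fun x : ℕ → X => ∫⁻ z, G (Function.update x n z) ∂μ :=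
    hupd.lintegral_prod_right'
  have hin' : Measurable fun q : (ℕ → X) × X =>
      ∫⁻ z, G (Function.update (Function.update q.1 m q.2) n z) ∂μ := hin.comp hm.measurable
  rw [← hn.lintegral_comp hG, lintegral_prod _ hupd.aemeasurable, ← hm.lintegral_comp hin,
    lintegral_prod _ hin'.aemeasurable]
  refine lintegral_congr fun x => ?_
  rw [lintegral_prod]
  have h1 : Measurable fun y : X => Function.update x m y :=
    hm.measurable.comp (f := fun y => (x, y)) (by fun_prop)
  exact (hupd.comp (f := fun p : X × X => (Function.update x m p.1, p.2)) (by fun_prop)).aemeasurable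

/-- If the functions `h k` depend only on the first `L` points of a sequence, then disjoint pairs
of later points can be integrated out. -/
theorem lintegral_prod_pairs {L : ℕ} {h : ℕ → (ℕ → X) → X × X → ℝ≥0∞}
    (hm : ∀ k, Measurable fun q : (ℕ → X) × (X × X) => h k q.1 q.2)
    (hdep : ∀ k c c', (∀ l < L, c l = c' l) → h k c = h k c') (K : ℕ)
    {Φ : (ℕ → X) → ℝ≥0∞} (hΦ : Measurable Φ) (hΦdep : ∀ c c', (∀ l < L, c l = c' l) → Φ c = Φ c') :
    ∫⁻ x, Φ x * ∏ k ∈ Finset.range K, h k x (x (L + 2 * k), x (L + 2 * k + 1))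
        ∂(Measure.infinitePi fun _ : ℕ => μ) =
      ∫⁻ x, Φ x * ∏ k ∈ Finset.range K, ∫⁻ p, h k x p ∂(μ.prod μ)
        ∂(Measure.infinitePi fun _ : ℕ => μ) := by
  have hfac : ∀ k, Measurable fun x : ℕ → X => h k x (x (L + 2 * k), x (L + 2 * k + 1)) := fun k =>
    (hm k).comp (f := fun x : ℕ → X => (x, (x (L + 2 * k), x (L + 2 * k + 1)))) (by fun_prop)
  -- Resampling the last pair affects neither Φ nor the other factors. Its integral depends only on
  -- the first L points and is absorbed into Φ, which is therefore kept general.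
  induction K generalizing Φ with
  | zero => simp
  | succ K ih =>
    have hprod : ∀ K, Measurable fun x : ℕ → X =>
        ∏ k ∈ Finset.range K, h k x (x (L + 2 * k), x (L + 2 * k + 1)) := fun K =>
      Finset.measurable_prod _ fun k _ => hfac k
    rw [lintegral_infinitePi_update_update μ (L + 2 * K) (L + 2 * K + 1)
      (G := fun x => Φ x * ∏ k ∈ Finset.range (K + 1), h k x (x (L + 2 * k), x (L + 2 * k + 1)))
      (hΦ.mul (hprod _))]
    have hint : Measurable fun x : ℕ → X => ∫⁻ p, h K x p ∂(μ.prod μ) := (hm K).lintegral_prod_right'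
    rw [lintegral_congr fun x => show _ = (Φ x * ∫⁻ p, h K x p ∂(μ.prod μ)) *
        ∏ k ∈ Finset.range K, h k x (x (L + 2 * k), x (L + 2 * k + 1)) from ?_]
    · rw [ih (Φ := fun x => Φ x * ∫⁻ p, h K x p ∂(μ.prod μ)) (hΦ.mul hint) fun c c' hc => by
        simp only [hΦdep c c' hc, hdep K c c' hc]]
      refine lintegral_congr fun x => ?_
      rw [Finset.prod_range_succ]
      ring
    · have hKx : Measurable (h K x) := (hm K).comp (f := fun p => (x, p)) (by fun_prop)
      rw [mul_right_comm, ← lintegral_const_mul _ hKx]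
      refine lintegral_congr fun p => ?_
      set y := Function.update (Function.update x (L + 2 * K) p.1) (L + 2 * K + 1) p.2 with hy
      have hyx : ∀ i, i ≠ L + 2 * K → i ≠ L + 2 * K + 1 → y i = x i := fun i h1 h2 => by
        simp [hy, h1, h2]
      have hlow : ∀ l < L, y l = x l := fun l hl => hyx l (by omega) (by omega)
      have hy1 : y (L + 2 * K) = p.1 := by simp [hy]
      have hy2 : y (L + 2 * K + 1) = p.2 := by simp [hy]
      rw [Finset.prod_range_succ, hΦdep y x hlow, hdep K y x hlow, hy1, hy2, ← mul_assoc]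
      congr 2
      refine Finset.prod_congr rfl fun k hk => ?_
      have hk' := Finset.mem_range.1 hk
      rw [hdep k y x hlow, hyx _ (by omega) (by omega), hyx _ (by omega) (by omega)]

end IntegrateOut

namespace QMMSpace

/-! ### The sampling law determines the law of the pair masses. -/

section Sampling

variable {X : Type*} [MeasurableSpace X] [StandardBorelSpace X] (Q : QMMSpace X)

/-- The law of the entries above the diagonal, given the sampled points. -/
noncomputable def sampleKernel : Kernel (ℕ → X) (Pairs → I) :=
  infinitePiKernel fun p => Q.dKernel.comap (fun x => (x p.1.1, x p.1.2)) (by fun_prop)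

instance : IsMarkovKernel Q.sampleKernel := by unfold sampleKernel; infer_instance

theorem sampleKernel_apply (x : ℕ → X) :
    Q.sampleKernel x = Measure.infinitePi fun p : Pairs => (Q.d (x p.1.1) (x p.1.2) : Measure I) := rfl

/-- The law of the entries above the diagonal of the sampled matrix. -/
noncomputable def sampleLaw : Measure (Pairs → I) := Q.sampleKernel ∘ₘ Q.anchorLaw

instance : IsProbabilityMeasure Q.sampleLaw := by unfold sampleLaw; infer_instance

theorem coe_τ_eq_map_sampleLaw : (Q.τ : Measure DistMatrix) = Q.sampleLaw.map symmetrize := by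
  ext A hA
  change Q.lawMatrixMeasure.bind LawMatrix.toMeasure A = _
  rw [Measure.bind_apply hA LawMatrix.measurable_toMeasure.aemeasurable, lawMatrixMeasure,
    lintegral_map (f := fun s : LawMatrix => s.toMeasure A) ((Measure.measurable_coe hA).comp LawMatrix.measurable_toMeasure) Q.measurable_lawMatrix,
    Measure.map_apply measurable_symmetrize hA, sampleLaw,
    Measure.bind_apply (measurable_symmetrize hA) Q.sampleKernel.measurable.aemeasurable]
  refine lintegral_congr fun x => ?_
  rw [LawMatrix.toMeasure, Measure.map_apply measurable_symmetrize hA]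
  rfl

theorem τ_eq_iff_sampleLaw_eq {Y : Type*} [MeasurableSpace Y] [StandardBorelSpace Y]
    (P : QMMSpace X) (Q : QMMSpace Y) : P.τ = Q.τ ↔ P.sampleLaw = Q.sampleLaw := by
  have hm : Measurable fun (D : DistMatrix) (p : Pairs) => D.1 p.1.1 p.1.2 :=
    measurable_pi_iff.2 fun p => (measurable_pi_apply _).comp
      ((measurable_pi_apply _).comp measurable_subtype_coe)
  have hinv : (fun (D : DistMatrix) (p : Pairs) => D.1 p.1.1 p.1.2) ∘ symmetrize = id := by
    funext u p
    simp [symmetrize, p.2]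
  constructor
  · intro h
    have h' : (P.τ : Measure DistMatrix) = Q.τ := by rw [h]
    rw [coe_τ_eq_map_sampleLaw, coe_τ_eq_map_sampleLaw] at h'
    have := congrArg (Measure.map fun (D : DistMatrix) (p : Pairs) => D.1 p.1.1 p.1.2) h'
    rwa [Measure.map_map hm measurable_symmetrize, Measure.map_map hm measurable_symmetrize, hinv,
      Measure.map_id, Measure.map_id] at this
  · intro h
    apply Subtype.ext
    exact (coe_τ_eq_map_sampleLaw P).trans (by rw [h]; exact (coe_τ_eq_map_sampleLaw Q).symm)

/-- The indices of the events on two rows of lengths and the length between their base points. -/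
abbrev PairEvent : Type := Finset (ℕ × ℕ) × Finset (ℕ × ℕ) × Finset ℕ

/-- The probability of a pair event, given the anchors `c` and the two points. -/
noncomputable def pairEventProb (e : PairEvent) (c : ℕ → X) (p : X × X) : ℝ≥0∞ :=
  Q.rowKernel (c, p.1) (rowCylinder e.1) * Q.rowKernel (c, p.2) (rowCylinder e.2.1) *
    (Q.d p.1 p.2 : Measure I) (genInter I e.2.2)

/-- The probability of a pair event, given the anchors `c`. -/
noncomputable def pairMass (c : ℕ → X) (e : PairEvent) : ℝ≥0∞ :=
  ∫⁻ p, Q.pairEventProb e c p ∂((Q.μ : Measure X).prod (Q.μ : Measure X))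

theorem measurable_pairEventProb (e : PairEvent) :
    Measurable fun q : (ℕ → X) × (X × X) => Q.pairEventProb e q.1 q.2 := by
  refine Measurable.mul (Measurable.mul ?_ ?_) ?_
  · exact (Q.rowKernel.measurable_coe (measurableSet_rowCylinder _)).comp
      (f := fun q : (ℕ → X) × (X × X) => (q.1, q.2.1)) (by fun_prop)
  · exact (Q.rowKernel.measurable_coe (measurableSet_rowCylinder _)).comp
      (f := fun q : (ℕ → X) × (X × X) => (q.1, q.2.2)) (by fun_prop)
  · exact (Q.measurable_d_apply (measurableSet_genInter _)).comp measurable_snd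

theorem measurable_pairMass (e : PairEvent) : Measurable fun c => Q.pairMass c e :=
  (Q.measurable_pairEventProb e).lintegral_prod_right'

theorem pairMass_le_one (c : ℕ → X) (e : PairEvent) : Q.pairMass c e ≤ 1 := by
  refine (lintegral_mono (g := fun _ => 1) fun p => ?_).trans (by simp)
  exact mul_le_one' (mul_le_one' prob_le_one prob_le_one) prob_le_one

theorem rowKernel_rowCylinder {a : Finset (ℕ × ℕ)} {L : ℕ} (hL : ∀ q ∈ a, q.1 < L)
    (c : ℕ → X) (x : X) : Q.rowKernel (c, x) (rowCylinder a) =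
      ∏ l : Fin L, (Q.d (c l) x : Measure I) (rowCylinderSide a l) := by
  rw [rowCylinder_eq_pi hL, rowKernel_apply,
    Measure.infinitePi_pi _ fun l _ => measurableSet_rowCylinderSide a l, Finset.prod_range]
  exact Finset.prod_congr rfl fun l _ => by rw [Q.d_symm]

/-- The positions in the matrix of the lengths between the first `L` points and disjoint pairs of
later points, and of the length within each pair. -/
def pairPosition (L : ℕ) : ℕ × (Fin L ⊕ Fin L ⊕ Unit) → Pairs
  | (k, .inl l) => ⟨(l, L + 2 * k), by have := l.2; dsimp only; omega⟩
  | (k, .inr (.inl l)) => ⟨(l, L + 2 * k + 1), by have := l.2; dsimp only; omega⟩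
  | (k, .inr (.inr _)) => ⟨(L + 2 * k, L + 2 * k + 1), by dsimp only; omega⟩

/-- Distinct events must concern distinct matrix entries, since only then are they conditionally
independent given the points. -/
theorem pairPosition_injective (L : ℕ) : Function.Injective (pairPosition L) := by
  rintro ⟨k, l | l | u⟩ ⟨k', l' | l' | u'⟩ h <;>
    simp only [pairPosition, Subtype.mk.injEq, Prod.mk.injEq] at h <;>
    obtain ⟨h1, h2⟩ := h <;>
    first
    | (exfalso; omega)
    | (obtain rfl : k = k' := by omega
       first
       | rfl
       | (obtain rfl : l = l' := Fin.ext h1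
          rfl))

/-- The set of admissible lengths at each position of `pairPosition`. -/
def pairSide (L : ℕ) (e : ℕ → PairEvent) : ℕ × (Fin L ⊕ Fin L ⊕ Unit) → Set I
  | (k, .inl l) => rowCylinderSide (e k).1 l
  | (k, .inr (.inl l)) => rowCylinderSide (e k).2.1 l
  | (k, .inr (.inr _)) => genInter I (e k).2.2

theorem measurableSet_pairSide (L : ℕ) (e : ℕ → PairEvent) (j : ℕ × (Fin L ⊕ Fin L ⊕ Unit)) :
    MeasurableSet (pairSide L e j) := by
  rcases j with ⟨k, l | l | u⟩
  · exact measurableSet_rowCylinderSide _ _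
  · exact measurableSet_rowCylinderSide _ _
  · exact measurableSet_genInter _

/-- The first L points serve as anchors, and the k-th event is tested on the fresh pair of points L
+ 2k, L + 2k + 1. Given the anchors these pairs are independent, so a product of pair masses becomes
a single probability. This is how one sampled matrix encodes all mixed moments. -/
theorem lintegral_prod_pairMass (K L : ℕ) (e : ℕ → PairEvent)
    (hL : ∀ k < K, (∀ q ∈ (e k).1, q.1 < L) ∧ ∀ q ∈ (e k).2.1, q.1 < L) :
    ∫⁻ c, ∏ k ∈ Finset.range K, Q.pairMass c (e k) ∂Q.anchorLaw =
      Q.sampleLaw {u | ∀ j ∈ Finset.range K ×ˢ Finset.univ, u (pairPosition L j) ∈ pairSide L e j} := by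
  classical
  -- Trivial events beyond K make the bound L valid for all k, as `lintegral_prod_pairs` requires.
  set e' : ℕ → PairEvent := fun k => if k < K then e k else (∅, ∅, ∅) with he'
  have hL' : ∀ k, (∀ q ∈ (e' k).1, q.1 < L) ∧ ∀ q ∈ (e' k).2.1, q.1 < L := by
    intro k
    by_cases hk : k < K
    · simpa [he', hk] using hL k hk
    · simp [he', hk]
  have hee : ∀ k ∈ Finset.range K, e k = e' k := fun k hk => by simp [he', Finset.mem_range.1 hk]
  set S : Finset (ℕ × (Fin L ⊕ Fin L ⊕ Unit)) := Finset.range K ×ˢ Finset.univ with hS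
  have hpre : {u : Pairs → I | ∀ j ∈ S, u (pairPosition L j) ∈ pairSide L e j} =
      (fun u j => u (pairPosition L j)) ⁻¹'
        Set.pi (S : Set (ℕ × (Fin L ⊕ Fin L ⊕ Unit)))
          (pairSide L e) := by
    ext u; simp only [Set.mem_ofPred_eq, Set.mem_preimage, Set.mem_pi, Finset.mem_coe]
  have hpi : MeasurableSet (Set.pi (S : Set (ℕ × (Fin L ⊕ Fin L ⊕ Unit))) (pairSide L e)) :=
    .pi (Finset.countable_toSet _) fun j _ => measurableSet_pairSide L e j
  have hmap : Measurable fun (u : Pairs → I) (j : ℕ × (Fin L ⊕ Fin L ⊕ Unit)) =>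
    u (pairPosition L j) := by fun_prop
  rw [hpre, sampleLaw, Measure.bind_apply (hmap hpi) Q.sampleKernel.measurable.aemeasurable]
  have hx : ∀ x : ℕ → X, Q.sampleKernel x ((fun u j => u (pairPosition L j)) ⁻¹'
        Set.pi (S : Set (ℕ × (Fin L ⊕ Fin L ⊕ Unit)))
          (pairSide L e)) =
      1 * ∏ k ∈ Finset.range K, Q.pairEventProb (e' k) x (x (L + 2 * k), x (L + 2 * k + 1)) := by
    intro x
    rw [← Measure.map_apply hmap hpi, sampleKernel_apply,
      Measure.map_infinitePi_infinitePi_of_inj (pairPosition_injective L),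
      Measure.infinitePi_pi _ fun j _ => measurableSet_pairSide L e j, hS, Finset.prod_product, one_mul]
    refine Finset.prod_congr rfl fun k hk => ?_
    rw [Fintype.prod_sum_type, Fintype.prod_sum_type, pairEventProb,
      Q.rowKernel_rowCylinder (hL' k).1, Q.rowKernel_rowCylinder (hL' k).2, ← hee k hk, mul_assoc]
    simp [pairPosition, pairSide]
  rw [lintegral_congr hx, lintegral_prod_pairs (Q.μ : Measure X) (L := L)
    (h := fun k => Q.pairEventProb (e' k)) (fun k => Q.measurable_pairEventProb _) ?_ K
    measurable_const fun _ _ _ => rfl]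
  · refine lintegral_congr fun x => ?_
    rw [one_mul]
    exact Finset.prod_congr rfl fun k hk => by rw [hee k hk]; rfl
  · intro k c c' hc
    funext p
    simp only [pairEventProb, Q.rowKernel_rowCylinder (hL' k).1, Q.rowKernel_rowCylinder (hL' k).2]
    simp only [fun l : Fin L => hc l l.2]

/-- The pair masses as a point of a countable power of the unit interval. -/
noncomputable def pairMassVector (c : ℕ → X) (e : PairEvent) : I :=
  ⟨(Q.pairMass c e).toReal, ENNReal.toReal_nonneg,
    ENNReal.toReal_le_of_le_ofReal zero_le_one (by simpa using Q.pairMass_le_one c e)⟩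

theorem measurable_pairMassVector : Measurable Q.pairMassVector :=
  measurable_pi_iff.2 fun e => (Q.measurable_pairMass e).ennreal_toReal.subtype_mk

theorem integral_prod_pairMassVector (K : ℕ) (e : ℕ → PairEvent) :
    ∫ v, ∏ k ∈ Finset.range K, (v (e k) : ℝ) ∂(Q.anchorLaw.map Q.pairMassVector) =
      (∫⁻ c, ∏ k ∈ Finset.range K, Q.pairMass c (e k) ∂Q.anchorLaw).toReal := by
  rw [integral_map Q.measurable_pairMassVector.aemeasurable
    (by fun_prop : Continuous _).aestronglyMeasurable]
  rw [← integral_toReal (Finset.measurable_prod _ fun k _ => Q.measurable_pairMass _).aemeasurable]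
  · simp [ENNReal.toReal_prod, pairMassVector]
  · exact ae_of_all _ fun c => (ENNReal.prod_lt_top fun k _ =>
      (Q.pairMass_le_one c _).trans_lt ENNReal.one_lt_top)

theorem map_pairMassVector_eq {Y : Type*} [MeasurableSpace Y] [StandardBorelSpace Y]
    {P : QMMSpace X} {Q : QMMSpace Y} (h : P.sampleLaw = Q.sampleLaw) :
    P.anchorLaw.map P.pairMassVector = Q.anchorLaw.map Q.pairMassVector := by
  have := Measure.isProbabilityMeasure_map (μ := P.anchorLaw) P.measurable_pairMassVector.aemeasurable
  have := Measure.isProbabilityMeasure_map (μ := Q.anchorLaw) Q.measurable_pairMassVector.aemeasurable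
  refine measure_ext_of_moments fun K e => ?_
  rw [integral_prod_pairMassVector, integral_prod_pairMassVector]
  -- Finitely many cylinders involve finitely many anchors; the shift by one turns the largest index
  -- into a strict bound.
  let L := (Finset.range K).sup fun k =>
    ((e k).1.sup fun q => q.1 + 1) ⊔ ((e k).2.1.sup fun q => q.1 + 1)
  have hL : ∀ k < K, (∀ q ∈ (e k).1, q.1 < L) ∧ ∀ q ∈ (e k).2.1, q.1 < L := by
    intro k hk
    have h0 := Finset.le_sup (f := fun k => ((e k).1.sup fun q => q.1 + 1) ⊔
      ((e k).2.1.sup fun q => q.1 + 1)) (Finset.mem_range.2 hk)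
    exact ⟨fun q hq => (Finset.le_sup (f := fun q : ℕ × ℕ => q.1 + 1) hq).trans
      (le_sup_left.trans h0), fun q hq => (Finset.le_sup (f := fun q : ℕ × ℕ => q.1 + 1) hq).trans
      (le_sup_right.trans h0)⟩
  rw [P.lintegral_prod_pairMass K L e hL, Q.lintegral_prod_pairMass K L e hL, h]

end Sampling

end QMMSpace

namespace QMMSpace

/-! ### Reconstruction from equal sampling laws. -/

section Reconstruction

variable {X : Type*} [MeasurableSpace X] [StandardBorelSpace X] (Q : QMMSpace X)

/-- Given the two points, the rows are independent with laws `rowKernel`, so integrating them out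
over the cylinders produces the factors of `pairEventProb`. -/
theorem setLIntegral_rowLaw_eq_pairMass (c : ℕ → X) (a b : Finset (ℕ × ℕ)) (s : Finset ℕ) :
    ∫⁻ p in (fun p : (X × (ℕ → I)) × (X × (ℕ → I)) => (p.1.2, p.2.2)) ⁻¹'
        (rowCylinder a ×ˢ rowCylinder b), (Q.d p.1.1 p.2.1 : Measure I) (genInter I s)
        ∂((Q.rowLaw c).prod (Q.rowLaw c)) = Q.pairMass c (a, b, s) := by
  have ha := measurableSet_rowCylinder a
  have hb := measurableSet_rowCylinder b
  have hd := Q.measurable_d_apply (measurableSet_genInter (α := I) s)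
  have hset : (fun p : (X × (ℕ → I)) × (X × (ℕ → I)) => (p.1.2, p.2.2)) ⁻¹'
      (rowCylinder a ×ˢ rowCylinder b) = (Set.univ ×ˢ rowCylinder a) ×ˢ (Set.univ ×ˢ rowCylinder b) := by
    ext p; simp
  have hd' : Measurable fun p : (X × (ℕ → I)) × (X × (ℕ → I)) =>
      (Q.d p.1.1 p.2.1 : Measure I) (genInter I s) :=
    hd.comp (f := fun p : (X × (ℕ → I)) × (X × (ℕ → I)) => (p.1.1, p.2.1)) (by fun_prop)
  have hpe : Measurable (Q.pairEventProb (a, b, s) c) :=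
    (Q.measurable_pairEventProb (a, b, s)).comp (f := fun p : X × X => (c, p)) (by fun_prop)
  rw [hset, ← Measure.prod_restrict, lintegral_prod _ hd'.aemeasurable, pairMass,
    lintegral_prod _ hpe.aemeasurable]
  have hinner : ∀ x : X, ∫⁻ q in Set.univ ×ˢ rowCylinder b,
      (Q.d x q.1 : Measure I) (genInter I s) ∂(Q.rowLaw c) =
      ∫⁻ z, (Q.d x z : Measure I) (genInter I s) * Q.rowKernel (c, z) (rowCylinder b) ∂Q.μ := by
    intro x
    have hdx : Measurable fun q : X × (ℕ → I) => (Q.d x q.1 : Measure I) (genInter I s) :=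
      hd.comp (f := fun q : X × (ℕ → I) => (x, q.1)) (by fun_prop)
    rw [rowLaw, Measure.setLIntegral_compProd hdx .univ hb]
    simp
  have hin : Measurable fun x : X => ∫⁻ z, (Q.d x z : Measure I) (genInter I s) *
      Q.rowKernel (c, z) (rowCylinder b) ∂Q.μ := by
    have h1 : Measurable fun p : X × X => Q.rowKernel (c, p.2) (rowCylinder b) :=
      (Q.rowKernel.measurable_coe hb).comp (f := fun p : X × X => (c, p.2)) (by fun_prop)
    exact (hd.mul h1).lintegral_prod_right'
  simp only [hinner]
  have hin' : Measurable fun q : X × (ℕ → I) => ∫⁻ z, (Q.d q.1 z : Measure I) (genInter I s) *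
      Q.rowKernel (c, z) (rowCylinder b) ∂Q.μ := hin.comp measurable_fst
  rw [rowLaw, Measure.setLIntegral_compProd hin' .univ ha]
  simp only [lintegral_const, Measure.restrict_univ, Measure.restrict_apply .univ, Set.univ_inter]
  refine lintegral_congr fun x => ?_
  rw [← lintegral_mul_const']
  · refine lintegral_congr fun z => ?_
    simp only [pairEventProb, Kernel.comap_apply]
    ring
  · exact measure_ne_top _ _

theorem map_snd_rowLaw_rowCylinder (c : ℕ → X) (a : Finset (ℕ × ℕ)) :
    (Q.rowLaw c).map Prod.snd (rowCylinder a) = Q.pairMass c (a, ∅, ∅) := by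
  rw [← setLIntegral_rowLaw_eq_pairMass, Measure.map_apply measurable_snd (measurableSet_rowCylinder a)]
  have : (fun p : (X × (ℕ → I)) × (X × (ℕ → I)) => (p.1.2, p.2.2)) ⁻¹'
      (rowCylinder a ×ˢ rowCylinder ∅) = (Prod.snd ⁻¹' rowCylinder a) ×ˢ Set.univ := by
    ext p; simp [rowCylinder_empty]
  simp [this, genInter_empty, Measure.prod_prod]

theorem map_snd_rowLaw_eq {Y : Type*} [MeasurableSpace Y] [StandardBorelSpace Y]
    {P : QMMSpace X} {Q : QMMSpace Y} {c : ℕ → X} {c' : ℕ → Y}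
    (h : P.pairMass c = Q.pairMass c') :
    (P.rowLaw c).map Prod.snd = (Q.rowLaw c').map Prod.snd := by
  have := Measure.isProbabilityMeasure_map (μ := P.rowLaw c) measurable_snd.aemeasurable
  refine measure_ext_rowCylinder fun a => ?_
  rw [map_snd_rowLaw_rowCylinder, map_snd_rowLaw_rowCylinder, h]

/-- If the pair masses relative to two sequences of anchors coincide, and if the distances are
determined by the lengths to the anchors, then they are the same function of these lengths. -/
theorem ae_eq_of_pairMass_eq {Y : Type*} [MeasurableSpace Y] [StandardBorelSpace Y]
    {P : QMMSpace X} {Q : QMMSpace Y} {c : ℕ → X} {c' : ℕ → Y}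
    (h : P.pairMass c = Q.pairMass c') {s : Finset ℕ} {W W' : (ℕ → I) → (ℕ → I) → ℝ≥0∞}
    (hW : Measurable (Function.uncurry W)) (hW' : Measurable (Function.uncurry W'))
    (hP : ∀ᵐ p ∂((P.rowLaw c).prod (P.rowLaw c)),
      (P.d p.1.1 p.2.1 : Measure I) (genInter I s) = W p.1.2 p.2.2)
    (hQ : ∀ᵐ p ∂((Q.rowLaw c').prod (Q.rowLaw c')),
      (Q.d p.1.1 p.2.1 : Measure I) (genInter I s) = W' p.1.2 p.2.2) :
    ∀ᵐ p ∂((P.rowLaw c).prod (P.rowLaw c)), W p.1.2 p.2.2 = W' p.1.2 p.2.2 := by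
  have hρ : (P.rowLaw c).map Prod.snd = (Q.rowLaw c').map Prod.snd :=
    map_snd_rowLaw_eq h
  set ρ := (P.rowLaw c).map Prod.snd with hρdef
  have hPρ : MeasurePreserving Prod.snd (P.rowLaw c) ρ := ⟨measurable_snd, rfl⟩
  have hQρ : MeasurePreserving Prod.snd (Q.rowLaw c') ρ := ⟨measurable_snd, hρ.symm⟩
  have hprob : IsProbabilityMeasure ρ := Measure.isProbabilityMeasure_map measurable_snd.aemeasurable
  have hP2 := hPρ.prod hPρ
  have hQ2 := hQρ.prod hQρ
  have hcyl : ∀ a b, MeasurableSet (rowCylinder a ×ˢ rowCylinder b) := fun a b =>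
    (measurableSet_rowCylinder a).prod (measurableSet_rowCylinder b)
  have h1 : ∀ a b, ∫⁻ q in rowCylinder a ×ˢ rowCylinder b, Function.uncurry W q ∂(ρ.prod ρ) =
      P.pairMass c (a, b, s) := by
    intro a b
    rw [← hP2.setLIntegral_comp_preimage (hcyl a b) hW, ← setLIntegral_rowLaw_eq_pairMass]
    exact lintegral_congr_ae (ae_restrict_of_ae (hP.mono fun p hp => hp.symm))
  have h2 : ∀ a b, ∫⁻ q in rowCylinder a ×ˢ rowCylinder b, Function.uncurry W' q ∂(ρ.prod ρ) =
      Q.pairMass c' (a, b, s) := by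
    intro a b
    rw [← hQ2.setLIntegral_comp_preimage (hcyl a b) hW', ← setLIntegral_rowLaw_eq_pairMass]
    exact lintegral_congr_ae (ae_restrict_of_ae (hQ.mono fun p hp => hp.symm))
  -- W is not assumed bounded, but its total integral is the pair mass with trivial row events,
  -- hence at most 1.
  have hfin : ∫⁻ q, Function.uncurry W q ∂(ρ.prod ρ) ≠ ∞ := by
    have := h1 ∅ ∅
    rw [rowCylinder_empty, Set.univ_prod_univ, setLIntegral_univ] at this
    rw [this]
    exact ne_top_of_le_ne_top ENNReal.one_ne_top (P.pairMass_le_one _ _)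
  have := isFiniteMeasure_withDensity hfin
  have hae : Function.uncurry W =ᵐ[ρ.prod ρ] Function.uncurry W' := by
    refine (withDensity_eq_iff hW.aemeasurable hW'.aemeasurable hfin).1
      (measure_ext_rowCylinder_prod fun a b => ?_)
    rw [withDensity_apply _ (hcyl a b), withDensity_apply _ (hcyl a b), h1, h2, h]
  exact hP2.quasiMeasurePreserving.ae hae

theorem exists_pullback_eq_of_sampleLaw_eq {Y : Type*} [MeasurableSpace Y] [StandardBorelSpace Y]
    {P : QMMSpace X} {Q : QMMSpace Y} (h : P.sampleLaw = Q.sampleLaw) :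
    ∃ (Ψ₁ : P.MPM) (Ψ₂ : Q.MPM), ∀ᵐ p : I × I ∂(volume.prod volume),
      P.pullback Ψ₁ p.1 p.2 = Q.pullback Ψ₂ p.1 p.2 := by
  obtain ⟨c, c', hcc, hc, hc'⟩ : ∃ (c : ℕ → X) (c' : ℕ → Y),
      P.pairMassVector c = Q.pairMassVector c' ∧
      (∀ s : Finset ℕ, ∃ W : (ℕ → I) → (ℕ → I) → ℝ≥0∞, Measurable (Function.uncurry W) ∧
        ∀ᵐ p ∂((P.rowLaw c).prod (P.rowLaw c)),
          (P.d p.1.1 p.2.1 : Measure I) (genInter I s) = W p.1.2 p.2.2) ∧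
      (∀ s : Finset ℕ, ∃ W : (ℕ → I) → (ℕ → I) → ℝ≥0∞, Measurable (Function.uncurry W) ∧
        ∀ᵐ p ∂((Q.rowLaw c').prod (Q.rowLaw c')),
          (Q.d p.1.1 p.2.1 : Measure I) (genInter I s) = W p.1.2 p.2.2) := by
    -- Under the coupling, equality of the pair masses and genericity of both anchor sequences hold
    -- almost surely, so some pair (c, c') has all three properties.
    obtain ⟨π, hπ, h1, h2, h3⟩ := exists_coupling_of_map_eq P.anchorLaw Q.anchorLaw
      P.measurable_pairMassVector Q.measurable_pairMassVector (map_pairMassVector_eq h)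
    have hP := ae_all_iff.2 fun s : Finset ℕ =>
      P.ae_exists_d_eq_comp_rows (measurableSet_genInter (α := I) s)
    have hQ := ae_all_iff.2 fun s : Finset ℕ =>
      Q.ae_exists_d_eq_comp_rows (measurableSet_genInter (α := I) s)
    rw [← h1] at hP
    rw [← h2] at hQ
    obtain ⟨p, hp1, hp2, hp3⟩ := (h3.and ((ae_of_ae_map measurable_fst.aemeasurable hP).and
      (ae_of_ae_map measurable_snd.aemeasurable hQ))).exists
    exact ⟨p.1, p.2, hp1, hp2, hp3⟩
  have hmass : P.pairMass c = Q.pairMass c' := by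
    funext e
    have := congrArg Subtype.val (congrFun hcc e)
    exact (ENNReal.toReal_eq_toReal_iff'
      (ne_top_of_le_ne_top ENNReal.one_ne_top (P.pairMass_le_one _ _))
      (ne_top_of_le_ne_top ENNReal.one_ne_top (Q.pairMass_le_one _ _))).1 this
  choose W hW hWP using hc
  choose W' hW' hWQ using hc'
  have hρ : (P.rowLaw c).map Prod.snd = (Q.rowLaw c').map Prod.snd :=
    map_snd_rowLaw_eq hmass
  obtain ⟨π, hπ, hπ1, hπ2, hπ3⟩ := exists_coupling_of_map_eq (P.rowLaw c) (Q.rowLaw c')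
    measurable_snd measurable_snd hρ
  have : Nonempty ((X × (ℕ → I)) × (Y × (ℕ → I))) := nonempty_of_isProbabilityMeasure π
  -- One parametrization of the glued measure by [0,1] gives both required maps as its two point
  -- components.
  obtain ⟨Ψ, hΨ, hΨπ⟩ := Measure.exists_measurable_map_eq π
  have hΨmp : MeasurePreserving Ψ volume π := ⟨hΨ, hΨπ⟩
  have hmp1 : MeasurePreserving Prod.fst π (P.rowLaw c) := ⟨measurable_fst, hπ1⟩
  have hmp2 : MeasurePreserving Prod.snd π (Q.rowLaw c') := ⟨measurable_snd, hπ2⟩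
  have hX : MeasurePreserving Prod.fst (P.rowLaw c) (P.μ : Measure X) :=
    ⟨measurable_fst, P.map_fst_rowLaw c⟩
  have hY : MeasurePreserving Prod.fst (Q.rowLaw c') (Q.μ : Measure Y) :=
    ⟨measurable_fst, Q.map_fst_rowLaw c'⟩
  have key : ∀ᵐ q ∂(π.prod π), P.d q.1.1.1 q.2.1.1 = Q.d q.1.2.1 q.2.2.1 := by
    have hall : ∀ᵐ q ∂(π.prod π), ∀ s : Finset ℕ,
        (P.d q.1.1.1 q.2.1.1 : Measure I) (genInter I s) =
          (Q.d q.1.2.1 q.2.2.1 : Measure I) (genInter I s) := by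
      refine ae_all_iff.2 fun s => ?_
      filter_upwards [(hmp1.prod hmp1).quasiMeasurePreserving.ae (hWP s),
        (hmp2.prod hmp2).quasiMeasurePreserving.ae (hWQ s),
        (hmp1.prod hmp1).quasiMeasurePreserving.ae
          (ae_eq_of_pairMass_eq hmass (hW s) (hW' s) (hWP s) (hWQ s)),
        Measure.quasiMeasurePreserving_fst.ae hπ3, Measure.quasiMeasurePreserving_snd.ae hπ3]
        with q h1 h2 h3 h4 h5
      simp only [Prod.map_fst, Prod.map_snd] at h1 h2 h3
      -- From P's distance to W, to W' at the same rows, to W' at the equal rows on Q's side, to Q's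
      -- distance.
      rw [h1, h3, h4, h5, h2]
    filter_upwards [hall] with q hq
    have heq : (P.d q.1.1.1 q.2.1.1 : Measure I) = Q.d q.1.2.1 q.2.2.1 := measure_ext_genInter hq
    exact Subtype.ext heq
  exact ⟨⟨fun t => (Ψ t).1.1, hX.comp (hmp1.comp hΨmp)⟩, ⟨fun t => (Ψ t).2.1, hY.comp (hmp2.comp hΨmp)⟩,
    (hΨmp.prod hΨmp).quasiMeasurePreserving.ae key⟩

end Reconstruction

end QMMSpace

/-! ### Stability of moments under the box distance. -/

section Real

theorem abs_prod_sub_prod_le_sum {ι : Type*} (S : Finset ι) {a b : ι → ℝ}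
    (ha : ∀ i ∈ S, |a i| ≤ 1) (hb : ∀ i ∈ S, |b i| ≤ 1) :
    |∏ i ∈ S, a i - ∏ i ∈ S, b i| ≤ ∑ i ∈ S, |a i - b i| := by
  classical
  induction S using Finset.induction_on with
  | empty => simp
  | insert j S hj ih =>
    rw [Finset.prod_insert hj, Finset.prod_insert hj, Finset.sum_insert hj]
    have ih' := ih (fun i hi => ha i (Finset.mem_insert_of_mem hi))
      fun i hi => hb i (Finset.mem_insert_of_mem hi)
    have hA : |∏ i ∈ S, a i| ≤ 1 := by
      rw [Finset.abs_prod]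
      exact Finset.prod_le_one (fun _ _ => abs_nonneg _)
        fun i hi => ha i (Finset.mem_insert_of_mem hi)
    calc |a j * ∏ i ∈ S, a i - b j * ∏ i ∈ S, b i|
        -- Telescoping: exchange one factor at a time.
        = |(a j - b j) * ∏ i ∈ S, a i + b j * (∏ i ∈ S, a i - ∏ i ∈ S, b i)| := by ring_nf
      _ ≤ |a j - b j| * |∏ i ∈ S, a i| + |b j| * |∏ i ∈ S, a i - ∏ i ∈ S, b i| := by
        rw [← abs_mul, ← abs_mul]; exact abs_add_le _ _
      _ ≤ |a j - b j| * 1 + 1 * ∑ i ∈ S, |a i - b i| := by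
        gcongr
        exact hb j (Finset.mem_insert_self j S)
      _ = _ := by ring

end Real

namespace QMMSpace

section Stability

theorem abs_integral_pow_sub_le {ν ν' : ProbabilityMeasure I} {ε : ℝ} (hε : 0 ≤ ε)
    (h : dExt ν ν' ≤ ENNReal.ofReal ε) (n : ℕ) :
    |∫ t, (t : ℝ) ^ n ∂(ν : Measure I) - ∫ t, (t : ℝ) ^ n ∂(ν' : Measure I)| ≤ n * ε := by
  rcases Nat.eq_zero_or_pos n with rfl | hn
  · simp
  have hn' : (0 : ℝ) < n := by exact_mod_cast hn
  -- On [0,1] the power t ^ n has Lipschitz constant n, so dividing by n makes it an admissible test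
  -- function.
  have hlip : LipschitzWith 1 fun t : I => (t : ℝ) ^ n / n := by
    refine LipschitzWith.of_dist_le_mul fun s t => ?_
    rw [Real.dist_eq, ← sub_div, abs_div, abs_of_pos hn', div_le_iff₀ hn', NNReal.coe_one, one_mul,
      Subtype.dist_eq, Real.dist_eq]
    refine abs_pow_sub_pow_le _ _ _ |>.trans ?_
    have hmax : max |(s : ℝ)| |(t : ℝ)| ≤ 1 :=
      max_le (abs_le.2 ⟨by linarith [s.2.1], s.2.2⟩) (abs_le.2 ⟨by linarith [t.2.1], t.2.2⟩)
    exact mul_le_of_le_one_right (by positivity) (pow_le_one₀ (by positivity) hmax)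
  have h1 : ENNReal.ofReal |∫ t, (t : ℝ) ^ n / n ∂(ν : Measure I) -
      ∫ t, (t : ℝ) ^ n / n ∂(ν' : Measure I)| ≤ ENNReal.ofReal ε :=
    (le_iSup₂ (f := fun (f : I → ℝ) (_ : LipschitzWith 1 f) =>
      ENNReal.ofReal |∫ t, f t ∂(ν : Measure I) - ∫ t, f t ∂(ν' : Measure I)|) _ hlip).trans h
  rw [ENNReal.ofReal_le_ofReal_iff hε, integral_div, integral_div, ← sub_div, abs_div,
    abs_of_pos hn', div_le_iff₀ hn'] at h1
  linarith

theorem abs_integral_pow_le_one (ν : ProbabilityMeasure I) (n : ℕ) :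
    |∫ t, (t : ℝ) ^ n ∂(ν : Measure I)| ≤ 1 := by
  have := norm_integral_le_of_norm_le_const (μ := (ν : Measure I)) (f := fun t : I => (t : ℝ) ^ n)
    (C := 1) (ae_of_all _ fun t => by
      rw [Real.norm_eq_abs, abs_of_nonneg (by have := t.2.1; positivity)]
      exact pow_le_one₀ t.2.1 t.2.2)
  simpa using this

theorem abs_integral_pow_sub_le_one (ν ν' : ProbabilityMeasure I) (n : ℕ) :
    |∫ t, (t : ℝ) ^ n ∂(ν : Measure I) - ∫ t, (t : ℝ) ^ n ∂(ν' : Measure I)| ≤ 1 := by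
  have h0 : ∀ ν : ProbabilityMeasure I, 0 ≤ ∫ t, (t : ℝ) ^ n ∂(ν : Measure I) := fun ν =>
    integral_nonneg fun t => pow_nonneg t.2.1 n
  have h1 := fun ν => (le_abs_self _).trans (abs_integral_pow_le_one ν n)
  rw [abs_le]
  constructor <;> linarith [h0 ν, h0 ν', h1 ν, h1 ν']

variable {X : Type*} [MeasurableSpace X] [StandardBorelSpace X] (Q : QMMSpace X)

theorem measurable_integral_pow_d (n : ℕ) :
    Measurable fun p : X × X => ∫ t, (t : ℝ) ^ n ∂(Q.d p.1 p.2 : Measure I) :=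
  (StronglyMeasurable.integral_kernel (κ := Q.dKernel) (f := fun t : I => (t : ℝ) ^ n)
    (by fun_prop : Continuous fun t : I => (t : ℝ) ^ n).stronglyMeasurable).measurable

-- Given the points the entries are independent, but a monomial may repeat an entry. Grouping
-- repetitions turns it into a product of powers of distinct entries, whose integral factorizes.
open Classical in
theorem integral_prod_sampleLaw (K : ℕ) (e : ℕ → Pairs) :
    ∫ u, ∏ k ∈ Finset.range K, (u (e k) : ℝ) ∂Q.sampleLaw =
      ∫ x, ∏ p ∈ (Finset.range K).image e,
        ∫ t, (t : ℝ) ^ ((Finset.range K).filter (e · = p)).card ∂(Q.d (x p.1.1) (x p.1.2) : Measure I)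
        ∂Q.anchorLaw := by
  have hcont : Continuous fun u : Pairs → I => ∏ k ∈ Finset.range K, (u (e k) : ℝ) := by fun_prop
  have hbd : ∀ u : Pairs → I, ‖∏ k ∈ Finset.range K, (u (e k) : ℝ)‖ ≤ 1 := fun u => by
    rw [Real.norm_eq_abs, Finset.abs_prod]
    exact Finset.prod_le_one (fun _ _ => abs_nonneg _) fun k _ =>
      (abs_of_nonneg (u (e k)).2.1).trans_le (u (e k)).2.2
  rw [sampleLaw, ← Measure.snd_compProd, Measure.snd, integral_map measurable_snd.aemeasurable
    hcont.aestronglyMeasurable, Measure.integral_compProd]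
  · refine integral_congr_ae (ae_of_all _ fun x => ?_)
    simp only [sampleKernel_apply]
    set n : Pairs → ℕ := fun p => ((Finset.range K).filter (e · = p)).card
    set S := (Finset.range K).image e
    have hind := iIndepFun_infinitePi
      (P := fun p : Pairs => (Q.d (x p.1.1) (x p.1.2) : Measure I))
      (X := fun p (t : I) => (t : ℝ) ^ n p) (fun p => by fun_prop)
    have hind' := hind.precomp (g := fun p : S => (p : Pairs)) Subtype.val_injective
    have h1 := hind'.integral_fun_prod_eq_prod_integral
      (fun p => (by fun_prop : Measurable fun u : Pairs → I =>
        (u (p : Pairs) : ℝ) ^ n p).aestronglyMeasurable)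
    calc ∫ u, ∏ k ∈ Finset.range K, (u (e k) : ℝ) ∂(Measure.infinitePi fun p : Pairs =>
            (Q.d (x p.1.1) (x p.1.2) : Measure I))
        = ∫ u, ∏ p : S, (u (p : Pairs) : ℝ) ^ n p ∂(Measure.infinitePi fun p : Pairs =>
            (Q.d (x p.1.1) (x p.1.2) : Measure I)) := by
          refine integral_congr_ae (ae_of_all _ fun u => ?_)
          simp only
          rw [Finset.prod_comp (fun p => (u p : ℝ)) e,
            Finset.prod_coe_sort S fun p => (u p : ℝ) ^ n p]
      _ = ∏ p : S, ∫ t, (t : ℝ) ^ n p ∂(Q.d (x (p : Pairs).1.1) (x (p : Pairs).1.2) : Measure I) := by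
          refine h1.trans (Finset.prod_congr rfl fun p _ => ?_)
          have hmp := measurePreserving_eval_infinitePi
            (fun p : Pairs => (Q.d (x p.1.1) (x p.1.2) : Measure I)) p
          rw [← hmp.map_eq, integral_map hmp.measurable.aemeasurable
            (by fun_prop : Continuous fun t : I => (t : ℝ) ^ n p).aestronglyMeasurable]
      _ = _ := Finset.prod_coe_sort S fun p =>
          ∫ t, (t : ℝ) ^ n p ∂(Q.d (x p.1.1) (x p.1.2) : Measure I)
  · exact .of_bound (hcont.measurable.comp measurable_snd).aestronglyMeasurable 1
      (ae_of_all _ fun q => hbd q.2)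

theorem map_anchorLaw (Ψ : Q.MPM) :
    (Measure.infinitePi fun _ : ℕ => (volume : Measure I)).map (fun ω i => Ψ.1 (ω i)) =
      Q.anchorLaw := by
  rw [Measure.infinitePi_map_pi _ fun _ => Ψ.2.measurable]
  simp only [Ψ.2.map_eq]

theorem measurable_prod_integral_pow_d (S : Finset Pairs) (n : Pairs → ℕ) :
    Measurable fun x : ℕ → X => ∏ p ∈ S,
      ∫ t, (t : ℝ) ^ n p ∂(Q.d (x p.1.1) (x p.1.2) : Measure I) :=
  Finset.measurable_prod _ fun p _ => (Q.measurable_integral_pow_d (n p)).comp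
    (f := fun x : ℕ → X => (x p.1.1, x p.1.2)) (by fun_prop)

theorem measurable_comp_MPM (Ψ : Q.MPM) : Measurable fun (ω : ℕ → I) (i : ℕ) => Ψ.1 (ω i) :=
  measurable_pi_iff.2 fun i => Ψ.2.measurable.comp (measurable_pi_apply i)

theorem integral_prod_pow_anchorLaw (Ψ : Q.MPM) (S : Finset Pairs) (n : Pairs → ℕ) :
    ∫ x, ∏ p ∈ S, ∫ t, (t : ℝ) ^ n p ∂(Q.d (x p.1.1) (x p.1.2) : Measure I) ∂Q.anchorLaw =
      ∫ ω, ∏ p ∈ S, ∫ t, (t : ℝ) ^ n p ∂(Q.pullback Ψ (ω p.1.1) (ω p.1.2) : Measure I)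
        ∂(Measure.infinitePi fun _ : ℕ => (volume : Measure I)) := by
  rw [← Q.map_anchorLaw Ψ, integral_map (Q.measurable_comp_MPM Ψ).aemeasurable
    (Q.measurable_prod_integral_pow_d S n).aestronglyMeasurable]
  rfl

theorem integrable_prod_pow_pullback (Ψ : Q.MPM) (S : Finset Pairs) (n : Pairs → ℕ) :
    Integrable (fun ω : ℕ → I =>
      ∏ p ∈ S, ∫ t, (t : ℝ) ^ n p ∂(Q.pullback Ψ (ω p.1.1) (ω p.1.2) : Measure I))
      (Measure.infinitePi fun _ : ℕ => (volume : Measure I)) := by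
  refine .of_bound ((Q.measurable_prod_integral_pow_d S n).comp
    (Q.measurable_comp_MPM Ψ)).aestronglyMeasurable 1 (ae_of_all _ fun ω => ?_)
  rw [Real.norm_eq_abs, Finset.abs_prod]
  exact Finset.prod_le_one (fun _ _ => abs_nonneg _) fun p _ => abs_integral_pow_le_one _ _

/-- Both integrals are pulled back to the same i.i.d. sequence in [0,1] and compared factor by
factor. Outside A a factor changes by at most n p * ε; otherwise it changes by at most 1, and each
of its two points lies in A with probability at most ε. This gives the constant n p + 2. -/
theorem abs_integral_prod_pow_sub_le {Y : Type*} [MeasurableSpace Y] [StandardBorelSpace Y]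
    (P : QMMSpace X) (Q : QMMSpace Y) (Ψ₁ : P.MPM) (Ψ₂ : Q.MPM) {ε : ℝ} (hε : 0 ≤ ε)
    {A : Set I} (hA : MeasurableSet A) (hAε : volume A ≤ ENNReal.ofReal ε)
    (h : ∀ᵐ p : I × I ∂(volume.prod volume), p.1 ∉ A → p.2 ∉ A →
      dExt (P.pullback Ψ₁ p.1 p.2) (Q.pullback Ψ₂ p.1 p.2) ≤ ENNReal.ofReal ε)
    (S : Finset Pairs) (n : Pairs → ℕ) :
    |∫ x, ∏ p ∈ S, ∫ t, (t : ℝ) ^ n p ∂(P.d (x p.1.1) (x p.1.2) : Measure I) ∂P.anchorLaw -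
      ∫ x, ∏ p ∈ S, ∫ t, (t : ℝ) ^ n p ∂(Q.d (x p.1.1) (x p.1.2) : Measure I) ∂Q.anchorLaw| ≤
      (∑ p ∈ S, ((n p : ℝ) + 2)) * ε := by
  rw [P.integral_prod_pow_anchorLaw Ψ₁, Q.integral_prod_pow_anchorLaw Ψ₂]
  set Λ := Measure.infinitePi fun _ : ℕ => (volume : Measure I)
  rw [← integral_sub (P.integrable_prod_pow_pullback Ψ₁ S n) (Q.integrable_prod_pow_pullback Ψ₂ S n)]
  have hmp : ∀ i : ℕ, MeasurePreserving (fun ω : ℕ → I => ω i) Λ volume := fun i =>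
    measurePreserving_eval_infinitePi (fun _ : ℕ => (volume : Measure I)) i
  let a : I → ℝ := A.indicator fun _ => 1
  have ha : Integrable a volume := (integrable_const _).indicator hA
  have hai : ∀ i : ℕ, Integrable (fun ω : ℕ → I => a (ω i)) Λ := fun i =>
    (hmp i).integrable_comp_of_integrable ha
  have hint : ∀ i : ℕ, ∫ ω, a (ω i) ∂Λ ≤ ε := by
    intro i
    have h1 : ∫ ω, a (ω i) ∂Λ = ∫ t, a t := by
      rw [← (hmp i).map_eq, integral_map (hmp i).measurable.aemeasurable
        (measurable_const.indicator hA).aestronglyMeasurable]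
    rw [h1, integral_indicator hA, setIntegral_const, smul_eq_mul, mul_one]
    exact ENNReal.toReal_le_of_le_ofReal hε hAε
  have hpair : ∀ᵐ ω ∂Λ, ∀ p : Pairs, ω p.1.1 ∉ A → ω p.1.2 ∉ A →
      dExt (P.pullback Ψ₁ (ω p.1.1) (ω p.1.2)) (Q.pullback Ψ₂ (ω p.1.1) (ω p.1.2)) ≤
        ENNReal.ofReal ε := by
    refine ae_all_iff.2 fun p => ?_
    -- Two coordinates with different indices are independent, so almost-everywhere statements on
    -- the square apply to them.
    have hmap := Measure.infinitePi_map_eval_prod (P := fun _ : ℕ => (volume : Measure I)) p.2.ne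
    rw [← hmap] at h
    exact ae_of_ae_map (by fun_prop) h
  have hbound : ∀ᵐ ω ∂Λ,
      ‖∏ p ∈ S, ∫ t, (t : ℝ) ^ n p ∂(P.pullback Ψ₁ (ω p.1.1) (ω p.1.2) : Measure I) -
        ∏ p ∈ S, ∫ t, (t : ℝ) ^ n p ∂(Q.pullback Ψ₂ (ω p.1.1) (ω p.1.2) : Measure I)‖ ≤
      ∑ p ∈ S, (n p * ε + (a (ω p.1.1) + a (ω p.1.2))) := by
    filter_upwards [hpair] with ω hω
    refine (abs_prod_sub_prod_le_sum S (fun p _ => abs_integral_pow_le_one _ _)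
      fun p _ => abs_integral_pow_le_one _ _).trans (Finset.sum_le_sum fun p _ => ?_)
    have h0 : ∀ t, 0 ≤ a t := fun t => Set.indicator_nonneg (fun _ _ => zero_le_one) t
    have hA1 : ∀ t ∈ A, a t = 1 := fun t ht => Set.indicator_of_mem ht _
    have hnε : 0 ≤ (n p : ℝ) * ε := by positivity
    by_cases h1 : ω p.1.1 ∈ A
    · have := abs_integral_pow_sub_le_one (P.pullback Ψ₁ (ω p.1.1) (ω p.1.2))
        (Q.pullback Ψ₂ (ω p.1.1) (ω p.1.2)) (n p)
      linarith [h0 (ω p.1.2), hA1 _ h1]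
    by_cases h2 : ω p.1.2 ∈ A
    · have := abs_integral_pow_sub_le_one (P.pullback Ψ₁ (ω p.1.1) (ω p.1.2))
        (Q.pullback Ψ₂ (ω p.1.1) (ω p.1.2)) (n p)
      linarith [h0 (ω p.1.1), hA1 _ h2]
    · linarith [abs_integral_pow_sub_le hε (hω p h1 h2) (n p), h0 (ω p.1.1), h0 (ω p.1.2)]
  have hsum : ∀ p : Pairs, Integrable (fun ω : ℕ → I => n p * ε + (a (ω p.1.1) + a (ω p.1.2))) Λ :=
    fun p => (integrable_const _).add ((hai _).add (hai _))
  refine (norm_integral_le_of_norm_le (integrable_finsetSum S fun p _ => hsum p) hbound).trans ?_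
  rw [integral_finsetSum S fun p _ => hsum p, Finset.sum_mul]
  refine Finset.sum_le_sum fun p _ => ?_
  have h2 : Integrable (fun ω : ℕ → I => a (ω p.1.1) + a (ω p.1.2)) Λ := (hai _).add (hai _)
  rw [integral_add (integrable_const _) h2, integral_add (hai _) (hai _)]
  simp only [integral_const, probReal_univ, one_smul]
  linarith [hint p.1.1, hint p.1.2]

theorem integral_prod_pow_eq_of_boxDist_eq_zero {Y : Type*} [MeasurableSpace Y]
    [StandardBorelSpace Y] {P : QMMSpace X} {Q : QMMSpace Y} (h : P.boxDist Q = 0)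
    (S : Finset Pairs) (n : Pairs → ℕ) :
    ∫ x, ∏ p ∈ S, ∫ t, (t : ℝ) ^ n p ∂(P.d (x p.1.1) (x p.1.2) : Measure I) ∂P.anchorLaw =
      ∫ x, ∏ p ∈ S, ∫ t, (t : ℝ) ^ n p ∂(Q.d (x p.1.1) (x p.1.2) : Measure I) ∂Q.anchorLaw := by
  have hC : 0 ≤ ∑ p ∈ S, ((n p : ℝ) + 2) := Finset.sum_nonneg fun p _ => by positivity
  refine eq_of_forall_dist_le fun δ hδ => ?_
  -- The added 1 keeps the denominator positive when S is empty.
  have hε : 0 < δ / (∑ p ∈ S, ((n p : ℝ) + 2) + 1) := by positivity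
  have hlt : P.boxDist Q < ENNReal.ofReal (δ / (∑ p ∈ S, ((n p : ℝ) + 2) + 1)) := by
    rw [h]; exact ENNReal.ofReal_pos.2 hε
  simp only [boxDist, iInf_lt_iff, box, sInf_lt_iff] at hlt
  obtain ⟨Ψ₁, Ψ₂, ε', ⟨A, hA, hAε, hae⟩, hε'⟩ := hlt
  refine (abs_integral_prod_pow_sub_le P Q Ψ₁ Ψ₂ hε.le hA (hAε.trans hε'.le)
    (hae.mono fun p hp h1 h2 => (hp h1 h2).trans hε'.le) S n).trans ?_
  rw [mul_div_assoc', div_le_iff₀ (by positivity)]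
  nlinarith

theorem sampleLaw_eq_of_boxDist_eq_zero {Y : Type*} [MeasurableSpace Y] [StandardBorelSpace Y]
    {P : QMMSpace X} {Q : QMMSpace Y} (h : P.boxDist Q = 0) : P.sampleLaw = Q.sampleLaw := by
  have : Nonempty Pairs := ⟨⟨(0, 1), one_pos⟩⟩
  refine measure_ext_of_moments fun K e => ?_
  rw [integral_prod_sampleLaw, integral_prod_sampleLaw]
  exact integral_prod_pow_eq_of_boxDist_eq_zero h _ _

theorem boxDist_eq_zero_of_pullback_ae_eq {Y : Type*} [MeasurableSpace Y] [StandardBorelSpace Y]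
    {P : QMMSpace X} {Q : QMMSpace Y} {Ψ₁ : P.MPM} {Ψ₂ : Q.MPM}
    (h : ∀ᵐ p : I × I ∂(volume.prod volume), P.pullback Ψ₁ p.1 p.2 = Q.pullback Ψ₂ p.1 p.2) :
    P.boxDist Q = 0 := by
  refine le_antisymm ((iInf₂_le Ψ₁ Ψ₂).trans (sInf_le ⟨∅, .empty, by simp, ?_⟩)) bot_le
  filter_upwards [h] with p hp _ _
  simp [hp, dExt]

end Stability

end QMMSpace

theorem mainTheorem2 {X Y : Type*} [MeasurableSpace X] [StandardBorelSpace X]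
    [MeasurableSpace Y] [StandardBorelSpace Y] (P : QMMSpace X) (Q : QMMSpace Y) :
    (P.τ = Q.τ ↔ P.boxDist Q = 0) ∧
      (P.τ = Q.τ → ∃ (Ψ₁ : P.MPM) (Ψ₂ : Q.MPM),
        ∀ᵐ p : I × I ∂(volume.prod volume),
          P.pullback Ψ₁ p.1 p.2 = Q.pullback Ψ₂ p.1 p.2) := by
  have hex := fun h : P.τ = Q.τ =>
    QMMSpace.exists_pullback_eq_of_sampleLaw_eq ((QMMSpace.τ_eq_iff_sampleLaw_eq P Q).1 h)
  refine ⟨⟨fun h => ?_, fun h => ?_⟩, hex⟩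
  · obtain ⟨Ψ₁, Ψ₂, hΨ⟩ := hex h
    exact QMMSpace.boxDist_eq_zero_of_pullback_ae_eq hΨ
  · exact (QMMSpace.τ_eq_iff_sampleLaw_eq P Q).2 (QMMSpace.sampleLaw_eq_of_boxDist_eq_zero h)
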